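/- Let $\mathbb{F}_q$ be a finite field with $q$ elements, and equip the field $\mathbb{F}_q((T^{-1}))$ of formal Laurent series with the absolute value $|0|=0$, $|\sum_{n\ge N}a_nT^{-n}|=q^{-N}$ if $a_N\neq 0$; denote also by $|\cdot|$ its unique extension to an algebraic closure of $\mathbb{F}_q((T^{-1}))$. The height $H(P)$ of $P\in(\mathbb{F}_q[T])[X]$ is the maximum of the absolute values of its coefficients. Every $\alpha\in\overline{\mathbb{F}_q(T)}$ is a root of exactly one non-constant, irreducible, primitive polynomial $P\in(\mathbb{F}_q[T])[X]$ whose leading coefficient is a monic polynomial in $T$; the degree and the height $H(\alpha)$ of $\alpha$ are those of this $P$. For an integer $n\ge 1$ and $\xi\in\mathbb{F}_q((T^{-1}))$, let $w_n(\xi)\in[0,+\infty]$ be the supremum of the real numbers $w$ such that $$0<|P(\xi)|\le H(P)^{-w}$$ for infinitely many $P\in(\mathbb{F}_q[T])[X]$ of degree at most $n$, and let $w_n^*(\xi)\in[0,+\infty]$ be the supremum of the real numbers $w^*$ such that $$0<|\xi-\alpha|\le H(\alpha)^{-w^*-1}$$ for infinitely many $\alpha\in\overline{\mathbb{F}_q(T)}$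 of degree at most $n$. Let $d\ge 2$ be an integer and $\delta\in[0,1]$. Then there exist uncountably many $\xi\in\mathbb{F}_q((T^{-1}))$ such that $w_n(\xi)$ and $w_n^*(\xi)$ are finite and $w_n(\xi)-w_n^*(\xi)=\delta$ for all integers $2\le n\le d$. In particular, the set of all values taken by $w_d-w_d^*$ contains the closed interval $[0,1]$. -/

import Mathlib

open scoped LaurentSeries

noncomputable section

namespace FqLaurent

/-! The field `𝔽_q((T⁻¹))` is modelled by the field `F⸨X⸩` of formal Laurent series over a finite
field `F` with `q` elements, the variable `X` of `F⸨X⸩` playing the role of `T⁻¹`: the series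
`∑ aₙ T⁻ⁿ` is the one with coefficients `aₙ`. -/

variable (F : Type*) [Field F] [Fintype F]

theorem one_lt_q : (1 : ℝ) < (Fintype.card F : ℝ) := by
  exact_mod_cast Fintype.one_lt_card

open scoped Classical in
/-- The absolute value on `𝔽_q((T⁻¹))`: `|0| = 0`, and `|ξ| = q ^ (-N)` if `a_N T⁻ᴺ` is the first
nonzero term of `ξ`. -/
def absL : AbsoluteValue F⸨X⸩ ℝ where
  toFun ξ := if ξ = 0 then 0 else (Fintype.card F : ℝ) ^ (-ξ.order)
  map_mul' ξ η := by
    by_cases h₁ : ξ = 0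
    · simp [h₁]
    by_cases h₂ : η = 0
    · simp [h₂]
    have hq := one_lt_q F
    rw [if_neg h₁, if_neg h₂, if_neg (mul_ne_zero h₁ h₂), HahnSeries.order_mul h₁ h₂, neg_add,
      zpow_add₀ (by positivity)]
  nonneg' ξ := by positivity
  eq_zero' ξ := by
    have hq := one_lt_q F
    by_cases h : ξ = 0
    · simp [h]
    · simp only [h, if_false, iff_false]
      positivity
  add_le' ξ η := by
    have hq := one_lt_q F
    by_cases h₁ : ξ = 0
    · simp [h₁]
    by_cases h₂ : η = 0
    · simp [h₂]
    by_cases h₃ : ξ + η = 0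
    · rw [if_pos h₃]
      positivity
    rw [if_neg h₁, if_neg h₂, if_neg h₃]
    have h := HahnSeries.min_order_le_order_add h₃
    have h₁' : 0 < (Fintype.card F : ℝ) ^ (-ξ.order) := by positivity
    have h₂' : 0 < (Fintype.card F : ℝ) ^ (-η.order) := by positivity
    rcases min_le_iff.1 h with h | h
    · have := zpow_le_zpow_right₀ hq.le (neg_le_neg h)
      linarith
    · have := zpow_le_zpow_right₀ hq.le (neg_le_neg h)
      linarith

variable {F}

open scoped Classical in
theorem absL_apply (ξ : F⸨X⸩) :
    absL F ξ = if ξ = 0 then 0 else (Fintype.card F : ℝ) ^ (-ξ.order) := rfl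

theorem absL_le_iff (ξ : F⸨X⸩) (N : ℤ) :
    absL F ξ ≤ (Fintype.card F : ℝ) ^ (-N) ↔ ∀ k < N, ξ.coeff k = 0 := by
  have hq := one_lt_q F
  rw [absL_apply]
  split_ifs with h
  · subst h
    simp only [HahnSeries.coeff_zero, implies_true, iff_true]
    positivity
  · rw [zpow_le_zpow_iff_right₀ hq, neg_le_neg_iff]
    constructor
    · intro h' k hk
      exact HahnSeries.coeff_eq_zero_of_lt_order (hk.trans_le h')
    · intro h'
      by_contra! hlt
      exact h (HahnSeries.coeff_order_eq_zero.1 (h' _ hlt))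

theorem absL_add_le_max (ξ η : F⸨X⸩) : absL F (ξ + η) ≤ max (absL F ξ) (absL F η) := by
  have hq := one_lt_q F
  by_cases h₁ : ξ = 0
  · simp [h₁]
  by_cases h₂ : η = 0
  · simp [h₂]
  by_cases h₃ : ξ + η = 0
  · rw [h₃, map_zero]
    exact le_max_of_le_left ((absL F).nonneg _)
  rw [absL_apply, absL_apply, absL_apply, if_neg h₁, if_neg h₂, if_neg h₃]
  have h := HahnSeries.min_order_le_order_add h₃
  rcases min_le_iff.1 h with h | h
  · exact le_max_of_le_left (zpow_le_zpow_right₀ hq.le (neg_le_neg h))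
  · exact le_max_of_le_right (zpow_le_zpow_right₀ hq.le (neg_le_neg h))

theorem complete_absL (s : ℕ → F⸨X⸩)
    (hs : ∀ ε > 0, ∃ N, ∀ m ≥ N, ∀ n ≥ N, absL F (s m - s n) < ε) :
    ∃ l, ∀ ε > 0, ∃ N, ∀ n ≥ N, absL F (s n - l) < ε := by
  have hq := one_lt_q F
  have key : ∀ N : ℕ, ∃ M, ∀ m ≥ M, ∀ n ≥ M, ∀ k : ℤ, k ≤ N → (s m).coeff k = (s n).coeff k := by
    intro N
    obtain ⟨M, hM⟩ := hs ((Fintype.card F : ℝ) ^ (-((N : ℤ) + 1))) (by positivity)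
    refine ⟨M, fun m hm n hn k hk => ?_⟩
    have h := hM m hm n hn
    have h' := (absL_le_iff (s m - s n) ((N : ℤ) + 1)).1 h.le k (by lia)
    rw [HahnSeries.coeff_sub] at h'
    exact sub_eq_zero.1 h'
  choose M hM using key
  let c : ℤ → F := fun k => (s (M k.toNat)).coeff k
  have hc : ∀ k < min 0 (s (M 0)).order, c k = 0 := by
    intro k hk
    have hk0 : k.toNat = 0 := by
      have := hk.trans_le (min_le_left _ _)
      lia
    simp only [c, hk0]
    exact HahnSeries.coeff_eq_zero_of_lt_order (hk.trans_le (min_le_right _ _))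
  let l : F⸨X⸩ := HahnSeries.ofSuppBddBelow c
    ⟨min 0 (s (M 0)).order, fun k hk => by
      by_contra! hlt
      exact hk (hc k hlt)⟩
  have hl : ∀ k, l.coeff k = (s (M k.toNat)).coeff k := fun k => rfl
  refine ⟨l, fun ε hε => ?_⟩
  obtain ⟨N, hN⟩ := exists_pow_lt_of_lt_one hε (inv_lt_one_of_one_lt₀ hq)
  refine ⟨(Finset.range (N + 1)).sup M, fun n hn => ?_⟩
  refine lt_of_le_of_lt ?_ hN
  rw [inv_pow, ← zpow_natCast, ← zpow_neg, absL_le_iff]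
  intro k hk
  have hkN : k.toNat ∈ Finset.range (N + 1) := by
    rw [Finset.mem_range]
    lia
  rw [HahnSeries.coeff_sub, hl, sub_eq_zero]
  exact hM k.toNat n ((Finset.le_sup hkN).trans hn) _ le_rfl k (Int.self_le_toNat k)

/-- A nontrivial, non-archimedean and complete absolute value on a field `K` has a unique extension
to any algebraic extension `L` of `K`. -/
theorem existsUnique_extension {K L : Type*} [Field K] [Field L] [Algebra K L]
    [Algebra.IsAlgebraic K L] (v : AbsoluteValue K ℝ) (hv₁ : ∃ x, 1 < v x)
    (hv₂ : ∀ x y, v (x + y) ≤ max (v x) (v y))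
    (hv₃ : ∀ s : ℕ → K, (∀ ε > 0, ∃ N, ∀ m ≥ N, ∀ n ≥ N, v (s m - s n) < ε) →
      ∃ l, ∀ ε > 0, ∃ N, ∀ n ≥ N, v (s n - l) < ε) :
    ∃! w : AbsoluteValue L ℝ, ∀ x, w (algebraMap K L x) = v x := by
  let : NontriviallyNormedField K := { v.toNormedField with non_trivial := hv₁ }
  have : IsUltrametricDist K := IsUltrametricDist.isUltrametricDist_of_forall_norm_add_le_max_norm hv₂
  have hd : ∀ x y : K, dist x y = v (x - y) := fun x y => dist_eq_norm x y
  have : CompleteSpace K := by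
    refine Metric.complete_of_cauchySeq_tendsto fun s hs => ?_
    obtain ⟨l, hl⟩ := hv₃ s (by simpa only [Metric.cauchySeq_iff, hd] using hs)
    exact ⟨l, by simpa only [Metric.tendsto_atTop, hd] using hl⟩
  refine ⟨{ toFun := spectralNorm K L
            map_mul' := map_mul (spectralMulAlgNorm K L)
            nonneg' := spectralNorm_nonneg
            eq_zero' := fun _ => map_eq_zero_iff_eq_zero (spectralMulAlgNorm K L)
            add_le' := map_add_le_add (spectralMulAlgNorm K L) },
    fun x => spectralNorm_extends x, fun w hw => ?_⟩
  ext x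
  exact spectralNorm_unique_field_norm_ext hw x

variable (F)

theorem existsUnique_absBar : ∃! w : AbsoluteValue (AlgebraicClosure F⸨X⸩) ℝ,
    ∀ ξ, w (algebraMap F⸨X⸩ (AlgebraicClosure F⸨X⸩) ξ) = absL F ξ := by
  refine existsUnique_extension (absL F) ⟨HahnSeries.single (-1) 1, ?_⟩ absL_add_le_max
    complete_absL
  have hq := one_lt_q F
  rw [absL_apply, if_neg (by simp), HahnSeries.order_single one_ne_zero]
  simpa using hq

/-- The unique extension of the absolute value of `𝔽_q((T⁻¹))` to its algebraic closure. -/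
def absBar : AbsoluteValue (AlgebraicClosure F⸨X⸩) ℝ :=
  (existsUnique_absBar F).choose

variable {F}

theorem absBar_algebraMap (ξ : F⸨X⸩) :
    absBar F (algebraMap F⸨X⸩ (AlgebraicClosure F⸨X⸩) ξ) = absL F ξ :=
  (existsUnique_absBar F).choose_spec.1 ξ


variable (F)

/-- The embedding of the polynomial ring `𝔽_q[T]` into `𝔽_q((T⁻¹))`, sending `T` to `(T⁻¹)⁻¹`. -/
def ofPoly : Polynomial F →+* F⸨X⸩ :=
  Polynomial.eval₂RingHom HahnSeries.C (HahnSeries.single (-1) 1)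

variable {F}

/-- The height of `P ∈ (𝔽_q[T])[X]`: the maximum of the absolute values of its coefficients. -/
def height (P : Polynomial (Polynomial F)) : ℝ :=
  (Finset.range (P.natDegree + 1)).sup' Finset.nonempty_range_add_one
    fun i => absL F (ofPoly F (P.coeff i))

/-- The value `P(ξ)` of `P ∈ (𝔽_q[T])[X]` at `ξ ∈ 𝔽_q((T⁻¹))`. -/
def evalL (P : Polynomial (Polynomial F)) (ξ : F⸨X⸩) : F⸨X⸩ :=
  P.eval₂ (ofPoly F) ξ

/-- The value `P(α)` of `P ∈ (𝔽_q[T])[X]` at `α` in the algebraic closure of `𝔽_q((T⁻¹))`. -/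
def evalBar (P : Polynomial (Polynomial F)) (α : AlgebraicClosure F⸨X⸩) : AlgebraicClosure F⸨X⸩ :=
  P.eval₂ ((algebraMap F⸨X⸩ (AlgebraicClosure F⸨X⸩)).comp (ofPoly F)) α

/-- `P` is the minimal polynomial of `α` over `𝔽_q[T]`: it is non-constant, irreducible and
primitive in `(𝔽_q[T])[X]`, its leading coefficient is a monic polynomial in `T`, and
`P(α) = 0`. Every `α` algebraic over `𝔽_q(T)` has exactly one such `P`, and no other `α` has one. -/
structure IsMinPoly (P : Polynomial (Polynomial F)) (α : AlgebraicClosure F⸨X⸩) : Prop where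
  natDegree_pos : 0 < P.natDegree
  irreducible : Irreducible P
  isPrimitive : P.IsPrimitive
  monic_leadingCoeff : P.leadingCoeff.Monic
  root : evalBar P α = 0

/-- The exponent `w_n(ξ)`: the supremum in `[-∞, +∞]` of the real numbers `w` such that
`0 < |P(ξ)| ≤ H(P) ^ (-w)` for infinitely many `P ∈ (𝔽_q[T])[X]` of degree at most `n`. -/
def wExp (n : ℕ) (ξ : F⸨X⸩) : EReal :=
  ⨆ w ∈ {w : ℝ | {P : Polynomial (Polynomial F) | P.natDegree ≤ n ∧
    0 < absL F (evalL P ξ) ∧ absL F (evalL P ξ) ≤ height P ^ (-w)}.Infinite}, (w : EReal)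

/-- The exponent `w_n^*(ξ)`: the supremum in `[-∞, +∞]` of the real numbers `w` such that
`0 < |ξ - α| ≤ H(α) ^ (-w - 1)` for infinitely many `α` algebraic over `𝔽_q(T)` of degree at most
`n`, where degree and height of `α` are those of its minimal polynomial `P`. -/
def wStar (n : ℕ) (ξ : F⸨X⸩) : EReal :=
  ⨆ w ∈ {w : ℝ | {α : AlgebraicClosure F⸨X⸩ | ∃ P, IsMinPoly P α ∧ P.natDegree ≤ n ∧
    0 < absBar F (algebraMap F⸨X⸩ (AlgebraicClosure F⸨X⸩) ξ - α) ∧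
    absBar F (algebraMap F⸨X⸩ (AlgebraicClosure F⸨X⸩) ξ - α) ≤
      height P ^ (-w - 1)}.Infinite}, (w : EReal)

end FqLaurent

end

/-! Suppose `ξ` has a sequence of minimal polynomials `P k` of degree at most two with height `q ^ h
k`, value `|P k (ξ)| = q ^ (-v k)` and derivative `|(P k)' (ξ)| = q ^ b k`. The root of `P k`
closest to `ξ` is then at distance `q ^ (-(v k + b k))`. If `v k / h k` is bounded and large in
terms of `d`, and `h (k + 1)` is at most a constant times `v k`, then no other irreducible
polynomial of degree at most `d` approximates `ξ` nearly as well. Indeed its resultant with a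
suitable `P k` is a nonzero polynomial in `T`, hence of absolute value at least one
(`IsApproxSeq.le_absL_evalL_of_irreducible`). Gauss's lemma makes the height multiplicative, which
extends this to products.

Hence, for `2 ≤ n ≤ d`, the exponent `w_n` is the limsup `w` of `v k / h k`, and `w_n^*` is the
limsup of `(v k + b k) / h k - 1`. If `b k / h k` tends to `1 - δ`, the latter is `w - δ`, and the
difference of the exponents is `δ` (`IsApproxSeq.wExp_sub_wStar`).

Such `ξ` are given by continued fractions. For `δ = 0` the partial quotients grow fast and `P k` is
the linear polynomial of a convergent, so that `b k = h k`. For `δ > 0` the partial quotients are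
constant on long blocks, and `P k` is the quadratic polynomial of the number obtained by repeating
the current block forever. Its height is read off at the start of the block, its value at `ξ` at the
end, and its derivative has the size of the repeated quotient (`IsCF.isApproxSeq_cfQuad`). The
degree of that quotient is a free parameter, which is tuned to give `b k / h k → 1 - δ`.

Each quotient (or block) may be `T ^ m` or `T ^ m + 1`. Since continued fraction expansions are
unique, this gives an injection of binary sequences into the solutions. -/

set_option linter.unusedSectionVars false

noncomputable section

namespace FqLaurent

open Polynomial Filter Topology

/-! ### Absolute values, heights and evaluation of polynomials. -/

section Basics

variable (F : Type*) [Field F] [Fintype F]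

/-- The real power `q ^ x`, where `q` is the number of elements of `F`. -/
def qr (x : ℝ) : ℝ := (Fintype.card F : ℝ) ^ x

theorem qr_pos (x : ℝ) : 0 < qr F x :=
  Real.rpow_pos_of_pos (zero_lt_one.trans (one_lt_q F)) x

theorem qr_add (x y : ℝ) : qr F (x + y) = qr F x * qr F y :=
  Real.rpow_add (zero_lt_one.trans (one_lt_q F)) x y

theorem qr_sub (x y : ℝ) : qr F (x - y) = qr F x / qr F y :=
  Real.rpow_sub (zero_lt_one.trans (one_lt_q F)) x y

theorem qr_rpow (x y : ℝ) : qr F x ^ y = qr F (x * y) :=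
  (Real.rpow_mul (zero_lt_one.trans (one_lt_q F)).le x y).symm

theorem qr_pow (x : ℝ) (n : ℕ) : qr F x ^ n = qr F (n * x) := by
  rw [← Real.rpow_natCast, qr_rpow, mul_comm]

theorem qr_zero : qr F 0 = 1 := Real.rpow_zero _

theorem qr_intCast (k : ℤ) : qr F k = (Fintype.card F : ℝ) ^ k := Real.rpow_intCast _ k

variable {F}

theorem qr_le_qr {x y : ℝ} : qr F x ≤ qr F y ↔ x ≤ y :=
  Real.rpow_le_rpow_left_iff (one_lt_q F)

theorem qr_lt_qr {x y : ℝ} : qr F x < qr F y ↔ x < y :=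
  Real.rpow_lt_rpow_left_iff (one_lt_q F)

theorem qr_inj {x y : ℝ} : qr F x = qr F y ↔ x = y := by
  simp only [le_antisymm_iff, qr_le_qr]

theorem one_le_qr {x : ℝ} (hx : 0 ≤ x) : 1 ≤ qr F x := by
  rw [← qr_zero F]
  exact qr_le_qr.2 hx

theorem exists_eq_qr {y : ℝ} (hy : 0 < y) : ∃ x, y = qr F x :=
  ⟨Real.logb (Fintype.card F) y,
    (Real.rpow_logb (zero_lt_one.trans (one_lt_q F)) (one_lt_q F).ne' hy).symm⟩

theorem coeff_ofPoly (f : F[X]) (k : ℤ) :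
    (ofPoly F f).coeff k = if k ≤ 0 then f.coeff (-k).toNat else 0 := by
  induction f using Polynomial.induction_on' with
  | add f g hf hg =>
    rw [map_add, HahnSeries.coeff_add, hf, hg]
    split_ifs <;> simp
  | monomial n a =>
    have h : ofPoly F (monomial n a) = HahnSeries.single (-(n : ℤ)) a := by
      simp only [ofPoly, coe_eval₂RingHom, eval₂_monomial, HahnSeries.single_pow]
      rw [HahnSeries.C_apply, HahnSeries.single_mul_single]
      simp
    rw [h, HahnSeries.coeff_single, coeff_monomial]
    split_ifs <;> first | rfl | lia

theorem absL_ofPoly {f : F[X]} (hf : f ≠ 0) : absL F (ofPoly F f) = qr F f.natDegree := by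
  have h1 : absL F (ofPoly F f) ≤ (Fintype.card F : ℝ) ^ (-(-(f.natDegree : ℤ))) := by
    rw [absL_le_iff]
    intro k hk
    rw [coeff_ofPoly]
    split_ifs
    · exact coeff_eq_zero_of_natDegree_lt (by lia)
    · rfl
  have h2 : (ofPoly F f).coeff (-(f.natDegree : ℤ)) ≠ 0 := by
    rw [coeff_ofPoly, if_pos (by lia)]
    simpa using hf
  have h3 : ofPoly F f ≠ 0 := by
    rintro h
    simp [h] at h2
  have h4 := HahnSeries.order_le_of_coeff_ne_zero h2
  refine le_antisymm ?_ ?_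
  · rw [neg_neg, ← qr_intCast] at h1
    simpa using h1
  · rw [absL_apply, if_neg h3, ← qr_intCast, qr_le_qr]
    have : (f.natDegree : ℤ) ≤ -(ofPoly F f).order := by lia
    exact_mod_cast this

theorem ofPoly_injective : Function.Injective (ofPoly F) := by
  rw [injective_iff_map_eq_zero]
  intro f hf
  by_contra h
  have := absL_ofPoly h
  rw [hf, map_zero] at this
  exact (qr_pos F _).ne this

theorem one_le_absL_ofPoly {f : F[X]} (hf : f ≠ 0) : 1 ≤ absL F (ofPoly F f) := by
  rw [absL_ofPoly hf]
  exact one_le_qr (Nat.cast_nonneg _)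

theorem absL_natCast_le_one (n : ℕ) : absL F (n : F⸨X⸩) ≤ 1 := by
  by_cases h : ((n : F[X])) = 0
  · have := congrArg (ofPoly F) h
    rw [map_natCast, map_zero] at this
    rw [this, map_zero]
    exact zero_le_one
  · have := absL_ofPoly h
    rw [map_natCast, natDegree_natCast, Nat.cast_zero, qr_zero] at this
    exact this.le

theorem isNonarchimedean_absL : IsNonarchimedean (absL F) := absL_add_le_max

/-- An absolute value bounded by one on the natural numbers is ultrametric, and the natural numbers
already lie in the base field. -/
theorem isNonarchimedean_absBar : IsNonarchimedean (absBar F) := by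
  let : NormedField (AlgebraicClosure F⸨X⸩) := (absBar F).toNormedField
  have : IsUltrametricDist (AlgebraicClosure F⸨X⸩) := by
    refine IsUltrametricDist.isUltrametricDist_of_forall_norm_natCast_le_one fun n => ?_
    have h : absBar F (n : AlgebraicClosure F⸨X⸩) ≤ 1 := by
      rw [← map_natCast (algebraMap F⸨X⸩ (AlgebraicClosure F⸨X⸩)), absBar_algebraMap]
      exact absL_natCast_le_one n
    exact h
  exact fun x y => IsUltrametricDist.norm_add_le_max x y

/-- The height, on the logarithmic scale to the base `q`. -/
def logHeight (P : F[X][X]) : ℕ := (Finset.range (P.natDegree + 1)).sup fun i => (P.coeff i).natDegree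

theorem natDegree_coeff_le_logHeight (P : F[X][X]) (i : ℕ) :
    (P.coeff i).natDegree ≤ logHeight P := by
  by_cases h : i ≤ P.natDegree
  · exact Finset.le_sup (f := fun i => (P.coeff i).natDegree) (Finset.mem_range.2 (by lia))
  · rw [coeff_eq_zero_of_natDegree_lt (by lia)]
    simp

theorem absL_coeff_le_height (P : F[X][X]) (i : ℕ) : absL F (ofPoly F (P.coeff i)) ≤ height P := by
  by_cases h : i ≤ P.natDegree
  · exact Finset.le_sup' (fun i => absL F (ofPoly F (P.coeff i))) (Finset.mem_range.2 (by lia))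
  · rw [coeff_eq_zero_of_natDegree_lt (by lia), map_zero, map_zero]
    exact ((absL F).nonneg _).trans
      (Finset.le_sup' (fun i => absL F (ofPoly F (P.coeff i))) (Finset.mem_range.2 (Nat.succ_pos _)))

theorem height_eq {P : F[X][X]} (hP : P ≠ 0) : height P = qr F (logHeight P) := by
  refine le_antisymm (Finset.sup'_le _ _ fun i _ => ?_) ?_
  · by_cases h : P.coeff i = 0
    · rw [h, map_zero, map_zero]
      exact (qr_pos F _).le
    · rw [absL_ofPoly h, qr_le_qr]
      exact_mod_cast natDegree_coeff_le_logHeight P i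
  · obtain ⟨i, -, hi⟩ := Finset.exists_mem_eq_sup (Finset.range (P.natDegree + 1))
      Finset.nonempty_range_add_one (fun i => (P.coeff i).natDegree)
    by_cases h : P.coeff i = 0
    · have h0 : logHeight P = 0 := by
        rw [logHeight, hi, h, natDegree_zero]
      have := absL_coeff_le_height P P.natDegree
      refine le_trans ?_ this
      rw [h0, Nat.cast_zero, qr_zero]
      exact one_le_absL_ofPoly (leadingCoeff_ne_zero.2 hP)
    · refine le_trans ?_ (absL_coeff_le_height P i)
      rw [absL_ofPoly h, logHeight, hi]

/-- Identifying the height with a Gauss norm of radius one makes Gauss's lemma available, so that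
heights multiply exactly and logarithmic heights add. -/
theorem height_eq_gaussNorm (P : F[X][X]) :
    height P = P.gaussNorm ((absL F).comp (ofPoly_injective (F := F))) 1 := by
  refine le_antisymm (Finset.sup'_le _ _ fun i _ => ?_) ?_
  · have := P.le_gaussNorm ((absL F).comp (ofPoly_injective (F := F))) zero_le_one i
    rwa [one_pow, mul_one] at this
  · obtain ⟨i, hi⟩ :=
      exists_eq_gaussNorm ((absL F).comp (ofPoly_injective (F := F))) 1 P
    rw [hi, one_pow, mul_one]
    exact absL_coeff_le_height P i

theorem height_mul (P Q : F[X][X]) : height (P * Q) = height P * height Q := by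
  simp only [height_eq_gaussNorm]
  refine gaussNorm_mul (fun f g => ?_) zero_lt_one P Q
  change absL F (ofPoly F (f + g)) ≤ _
  rw [map_add]
  exact absL_add_le_max (ofPoly F f) (ofPoly F g)

theorem logHeight_mul {P Q : F[X][X]} (hP : P ≠ 0) (hQ : Q ≠ 0) :
    logHeight (P * Q) = logHeight P + logHeight Q := by
  have := height_mul P Q
  rw [height_eq hP, height_eq hQ, height_eq (mul_ne_zero hP hQ), ← qr_add, qr_inj] at this
  exact_mod_cast this

theorem logHeight_unit {P : F[X][X]} (hP : IsUnit P) : logHeight P = 0 := by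
  obtain ⟨Q, hQ⟩ := hP.exists_right_inv
  have h := logHeight_mul (P := P) (Q := Q) hP.ne_zero (right_ne_zero_of_mul_eq_one hQ)
  have h1 : logHeight (1 : F[X][X]) = 0 := by simp [logHeight]
  rw [hQ, h1] at h
  lia

theorem logHeight_eq_of_associated {P Q : F[X][X]} (h : Associated P Q) :
    logHeight P = logHeight Q := by
  obtain ⟨u, rfl⟩ := h
  by_cases hP : P = 0
  · simp [hP]
  rw [logHeight_mul hP u.ne_zero, logHeight_unit u.isUnit, add_zero]

theorem finite_natDegree_le (n : ℕ) : {f : F[X] | f.natDegree ≤ n}.Finite := by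
  refine Set.Finite.of_finite_image (f := fun f (i : Fin (n + 1)) => f.coeff i)
    (Set.toFinite _) ?_
  intro f hf g hg hfg
  ext i
  by_cases hi : i ≤ n
  · exact congrFun hfg ⟨i, by lia⟩
  · simp only [Set.mem_ofPred_eq] at hf hg
    rw [coeff_eq_zero_of_natDegree_lt (by lia), coeff_eq_zero_of_natDegree_lt (by lia)]

/-- Northcott's property. Both exponents are bounded above by showing that the polynomials concerned
have bounded height. -/
theorem finite_logHeight_le (n h : ℕ) :
    {P : F[X][X] | P.natDegree ≤ n ∧ logHeight P ≤ h}.Finite := by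
  refine Set.Finite.of_finite_image (f := fun P (i : Fin (n + 1)) => P.coeff i)
    (Set.Finite.subset (Set.Finite.pi' fun _ : Fin (n + 1) => finite_natDegree_le (F := F) h) ?_) ?_
  · rintro _ ⟨P, hP, rfl⟩ i
    exact (natDegree_coeff_le_logHeight P i).trans hP.2
  intro P hP Q hQ hPQ
  ext1 i
  by_cases hi : i ≤ n
  · exact congrFun hPQ ⟨i, by lia⟩
  · rw [coeff_eq_zero_of_natDegree_lt (by have := hP.1; lia),
      coeff_eq_zero_of_natDegree_lt (by have := hQ.1; lia)]

variable (F) in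
/-- The embedding of `𝔽_q[T]` into the algebraic closure of `𝔽_q((T⁻¹))`. -/
abbrev polyBar : F[X] →+* AlgebraicClosure F⸨X⸩ :=
  (algebraMap F⸨X⸩ (AlgebraicClosure F⸨X⸩)).comp (ofPoly F)

theorem polyBar_injective : Function.Injective (polyBar F) :=
  (algebraMap F⸨X⸩ (AlgebraicClosure F⸨X⸩)).injective.comp ofPoly_injective

theorem absBar_polyBar (f : F[X]) : absBar F (polyBar F f) = absL F (ofPoly F f) :=
  absBar_algebraMap _

theorem evalBar_algebraMap (P : F[X][X]) (ξ : F⸨X⸩) :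
    evalBar P (algebraMap F⸨X⸩ (AlgebraicClosure F⸨X⸩) ξ)
      = algebraMap F⸨X⸩ (AlgebraicClosure F⸨X⸩) (evalL P ξ) :=
  (hom_eval₂ P (ofPoly F) (algebraMap F⸨X⸩ (AlgebraicClosure F⸨X⸩)) ξ).symm

theorem absBar_evalBar_algebraMap (P : F[X][X]) (ξ : F⸨X⸩) :
    absBar F (evalBar P (algebraMap F⸨X⸩ (AlgebraicClosure F⸨X⸩) ξ)) = absL F (evalL P ξ) := by
  rw [evalBar_algebraMap, absBar_algebraMap]

theorem height_nonneg (P : F[X][X]) : 0 ≤ height P :=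
  ((absL F).nonneg _).trans (absL_coeff_le_height P 0)

theorem absBar_sum_le {ι : Type*} {s : Finset ι} {f : ι → AlgebraicClosure F⸨X⸩} {M : ℝ}
    (hM : 0 ≤ M) (h : ∀ i ∈ s, absBar F (f i) ≤ M) : absBar F (∑ i ∈ s, f i) ≤ M := by
  rcases s.eq_empty_or_nonempty with rfl | hs
  · simpa using hM
  · exact (isNonarchimedean_absBar.apply_sum_le_sup hs).trans (Finset.sup'_le _ _ h)

theorem absBar_evalBar_le (P : F[X][X]) {α : AlgebraicClosure F⸨X⸩} (hα : absBar F α ≤ 1) :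
    absBar F (evalBar P α) ≤ height P := by
  rw [evalBar, eval₂_eq_sum_range]
  refine absBar_sum_le (height_nonneg P) fun i _ => ?_
  rw [map_mul, map_pow, absBar_polyBar]
  exact (mul_le_of_le_one_right ((absL F).nonneg _) (pow_le_one₀ ((absBar F).nonneg _) hα)).trans
    (absL_coeff_le_height P i)

theorem absBar_evalBar_sub_le (P : F[X][X]) {α β : AlgebraicClosure F⸨X⸩} (hα : absBar F α ≤ 1)
    (hβ : absBar F β ≤ 1) :
    absBar F (evalBar P α - evalBar P β) ≤ height P * absBar F (α - β) := by
  have h0 := (absBar F).nonneg (α - β)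
  rw [evalBar, evalBar, eval₂_eq_sum_range, eval₂_eq_sum_range, ← Finset.sum_sub_distrib]
  refine absBar_sum_le (mul_nonneg (height_nonneg P) h0) fun i _ => ?_
  rw [← mul_sub, map_mul, absBar_polyBar]
  refine mul_le_mul (absL_coeff_le_height P i) ?_ ((absBar F).nonneg _) (height_nonneg P)
  rw [← geom_sum₂_mul, map_mul]
  refine mul_le_of_le_one_left h0 (absBar_sum_le zero_le_one fun j _ => ?_)
  rw [map_mul, map_pow, map_pow]
  exact mul_le_one₀ (pow_le_one₀ ((absBar F).nonneg _) hα) (pow_nonneg ((absBar F).nonneg _) _)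
    (pow_le_one₀ ((absBar F).nonneg _) hβ)

theorem absBar_sub_comm (α β : AlgebraicClosure F⸨X⸩) : absBar F (α - β) = absBar F (β - α) :=
  (absBar F).map_sub α β

end Basics

/-! ### Roots of polynomials of degree at most two, and resultants. -/

section Roots

variable {F : Type*} [Field F] [Fintype F]

theorem evalBar_eq_eval_map (P : F[X][X]) (α : AlgebraicClosure F⸨X⸩) :
    evalBar P α = (P.map (polyBar F)).eval α :=
  eval₂_eq_eval_map _

theorem mem_roots_map_polyBar {P : F[X][X]} (hP : P ≠ 0) {α : AlgebraicClosure F⸨X⸩} :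
    α ∈ (P.map (polyBar F)).roots ↔ evalBar P α = 0 := by
  rw [mem_roots ((Polynomial.map_ne_zero_iff polyBar_injective).2 hP), IsRoot.def,
    evalBar_eq_eval_map]

theorem card_roots_map_polyBar (P : F[X][X]) :
    (P.map (polyBar F)).roots.card = P.natDegree := by
  rw [← (IsAlgClosed.splits (P.map (polyBar F))).natDegree_eq_card_roots,
    natDegree_map_eq_of_injective polyBar_injective]

theorem map_polyBar_eq_prod (P : F[X][X]) : P.map (polyBar F) = C (polyBar F P.leadingCoeff) *
    ((P.map (polyBar F)).roots.map fun α => X - C α).prod := by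
  rw [← leadingCoeff_map_of_injective polyBar_injective]
  exact (IsAlgClosed.splits (P.map (polyBar F))).eq_prod_roots

theorem ne_zero_of_natDegree_pos {P : F[X][X]} (h : 0 < P.natDegree) : P ≠ 0 := by
  rintro rfl
  simp at h

/-- When the leading coefficient attains the height, the leading term would strictly dominate all
others at a point of absolute value greater than one. -/
theorem absBar_root_le_one {P : F[X][X]} (hP : P ≠ 0)
    (hlead : P.leadingCoeff.natDegree = logHeight P) {α : AlgebraicClosure F⸨X⸩}
    (hα : evalBar P α = 0) : absBar F α ≤ 1 := by
  by_contra! h1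
  have hH : absL F (ofPoly F P.leadingCoeff) = height P := by
    rw [absL_ofPoly (leadingCoeff_ne_zero.2 hP), height_eq hP, hlead]
  have hHpos : 0 < height P := by
    rw [height_eq hP]
    exact qr_pos F _
  rw [evalBar, eval₂_eq_sum_range, Finset.sum_range_succ, add_comm] at hα
  have h2 := congrArg (absBar F) (eq_neg_of_add_eq_zero_left hα)
  rw [AbsoluteValue.map_neg, map_mul, map_pow, absBar_polyBar, coeff_natDegree, hH] at h2
  rcases Nat.eq_zero_or_pos P.natDegree with h0 | h0
  · rw [h0] at h2
    simp only [pow_zero, mul_one, Finset.range_zero, Finset.sum_empty, map_zero] at h2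
    exact hHpos.ne' h2
  · have h3 : height P * absBar F α ^ P.natDegree ≤ height P * absBar F α ^ (P.natDegree - 1) := by
      rw [h2]
      refine absBar_sum_le (by positivity) fun i hi => ?_
      rw [map_mul, map_pow, absBar_polyBar]
      have : i ≤ P.natDegree - 1 := by
        rw [Finset.mem_range] at hi
        lia
      exact mul_le_mul (absL_coeff_le_height P i) (pow_le_pow_right₀ h1.le this) (by positivity)
        hHpos.le
    have h4 := le_of_mul_le_mul_left h3 hHpos
    exact absurd h4 (not_le.2 (pow_lt_pow_right₀ h1 (by lia)))

/-- This is `|x - α| = |P(x)| / |P'(x)|`. For two roots, `P'(x)` is the leading coefficient times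
`(x - β) + (x - α)`, and `hvb` forces one of the two distances to dominate. -/
theorem exists_closest_root {P : F[X][X]} (hP0 : 0 < P.natDegree) (hP2 : P.natDegree ≤ 2)
    (hlead : P.leadingCoeff.natDegree = logHeight P) {x : AlgebraicClosure F⸨X⸩} {v b : ℝ}
    (hv : absBar F (evalBar P x) = qr F (-v))
    (hb : absBar F (evalBar (derivative P) x) = qr F b)
    (hvb : logHeight P < v + 2 * b) :
    ∃ α, evalBar P α = 0 ∧ absBar F (x - α) = qr F (-(v + b)) ∧
      ∀ β, evalBar P β = 0 → qr F (-(v + b)) ≤ absBar F (x - β) := by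
  have hP := ne_zero_of_natDegree_pos hP0
  have hH : absBar F (polyBar F P.leadingCoeff) = qr F (logHeight P) := by
    rw [absBar_polyBar, absL_ofPoly (leadingCoeff_ne_zero.2 hP), hlead]
  have hcard := card_roots_map_polyBar P
  have hprod := map_polyBar_eq_prod P
  rw [evalBar_eq_eval_map] at hv
  rw [evalBar_eq_eval_map, ← derivative_map] at hb
  simp only [← mem_roots_map_polyBar hP]
  generalize (P.map (polyBar F)).roots = R at *
  have hcases : R.card = 1 ∨ R.card = 2 := by lia
  rcases hcases with h1 | h2
  · obtain ⟨α, rfl⟩ := Multiset.card_eq_one.1 h1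
    simp only [Multiset.map_singleton, Multiset.prod_singleton] at hprod
    rw [hprod] at hv hb
    simp only [derivative_C_mul, derivative_sub, derivative_X, derivative_C, eval_mul, eval_C,
      eval_sub, eval_X, sub_zero, mul_one, map_mul, hH, qr_inj] at hv hb
    have h3 : absBar F (x - α) = qr F (-(v + b)) := by
      refine mul_left_cancel₀ (qr_pos F (logHeight P)).ne' ?_
      rw [hv, ← qr_add, hb]
      congr 1
      ring
    refine ⟨α, by simp, h3, fun β hβ => ?_⟩
    rw [Multiset.mem_singleton.1 hβ, h3]
  · obtain ⟨α, β, rfl⟩ := Multiset.card_eq_two.1 h2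
    wlog hle : absBar F (x - α) ≤ absBar F (x - β) generalizing α β
    · rw [Multiset.pair_comm] at *
      exact this β α hcard hprod h2 (le_of_not_ge hle)
    simp only [Multiset.insert_eq_cons, Multiset.map_cons, Multiset.prod_cons,
      Multiset.map_singleton, Multiset.prod_singleton] at hprod
    rw [hprod] at hv hb
    simp only [derivative_mul, derivative_sub, derivative_X, derivative_C,
      eval_mul, eval_C, eval_sub, eval_X, eval_add, sub_zero, mul_one, one_mul, map_mul, hH,
      zero_mul, zero_add] at hv hb
    have hne : x - α ≠ 0 := by
      intro h
      rw [h] at hv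
      simp only [map_zero, zero_mul, mul_zero] at hv
      exact (qr_pos F _).ne hv
    have hne' : x - β ≠ 0 := by
      intro h
      rw [h] at hv
      simp only [map_zero, mul_zero] at hv
      exact (qr_pos F _).ne hv
    obtain ⟨s, hs⟩ := exists_eq_qr (F := F) ((absBar F).pos hne)
    obtain ⟨t, ht⟩ := exists_eq_qr (F := F) ((absBar F).pos hne')
    rw [hs, ht, qr_le_qr] at hle
    rw [hs, ht, ← qr_add, ← qr_add, qr_inj] at hv
    have hmax : b ≤ logHeight P + t := by
      have := isNonarchimedean_absBar (x - β) (x - α)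
      rw [hs, ht, max_eq_left (qr_le_qr.2 hle)] at this
      rw [← qr_le_qr (F := F), ← hb, qr_add]
      gcongr
      exact (qr_pos F _).le
    -- With `s = t` one would get `v = -(h + 2 t)` and `b ≤ h + t`, hence `v + 2 b ≤ h`, for `h =
    -- logHeight P`.
    have hst : s < t := by
      by_contra!
      linarith
    have htb : (logHeight P : ℝ) + t = b := by
      have := isNonarchimedean_absBar.add_eq_left_of_lt (x := x - β) (y := x - α)
        (by rw [hs, ht]; exact qr_lt_qr.2 hst)
      rwa [this, ht, ← qr_add, qr_inj] at hb
    have hsv : s = -(v + b) := by linarith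
    refine ⟨α, by simp, by rw [hs, hsv], fun γ hγ => ?_⟩
    simp only [Multiset.insert_eq_cons, Multiset.mem_cons, Multiset.mem_singleton] at hγ
    rcases hγ with rfl | rfl
    · rw [hs, hsv]
    · rw [ht, qr_le_qr]
      linarith

/-- By Gauss's lemma, irreducibility and non-divisibility persist over the field of fractions, where
they give coprimality. -/
theorem resultant_ne_zero_of_not_dvd {P Q : F[X][X]} (hP : Irreducible P) (hP' : P.IsPrimitive)
    (hPQ : ¬ P ∣ Q) : resultant P Q ≠ 0 := by
  let K := FractionRing F[X]
  have hinj : Function.Injective (algebraMap F[X] K) := IsFractionRing.injective _ _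
  have h1 : Irreducible (P.map (algebraMap F[X] K)) :=
    (hP'.irreducible_iff_irreducible_map_fraction_map (K := K)).1 hP
  have h2 : IsCoprime (P.map (algebraMap F[X] K)) (Q.map (algebraMap F[X] K)) := by
    rw [h1.coprime_iff_not_dvd]
    exact fun h => hPQ (hP'.dvd_of_fraction_map_dvd_fraction_map h)
  have h3 := resultant_ne_zero _ _ h2
  rw [natDegree_map_eq_of_injective hinj, natDegree_map_eq_of_injective hinj,
    resultant_map_map] at h3
  intro h
  rw [h, map_zero] at h3
  exact h3 rfl

/-- A Liouville inequality: the resultant is a nonzero element of `F[X]`, so its absolute value is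
at least one. It is also a power of the leading coefficient of `P` times the product of the values
of `Q` at the roots of `P`. At most one root differs from `α`, and there `Q` is bounded by its
height. -/
theorem one_le_mul_absBar_evalBar {P Q : F[X][X]} (hP : Irreducible P) (hP' : P.IsPrimitive)
    (hP2 : P.natDegree ≤ 2) (hlead : P.leadingCoeff.natDegree = logHeight P) (hPQ : ¬ P ∣ Q)
    {α : AlgebraicClosure F⸨X⸩} (hα : evalBar P α = 0) :
    1 ≤ qr F (Q.natDegree * logHeight P + logHeight Q) * absBar F (evalBar Q α) := by
  have hQ0 : Q ≠ 0 := fun h => hPQ (h ▸ dvd_zero P)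
  have hH : absBar F (polyBar F P.leadingCoeff) = qr F (logHeight P) := by
    rw [absBar_polyBar, absL_ofPoly (leadingCoeff_ne_zero.2 hP.ne_zero), hlead]
  have h1 : 1 ≤ absBar F (polyBar F (resultant P Q)) := by
    rw [absBar_polyBar]
    exact one_le_absL_ofPoly (resultant_ne_zero_of_not_dvd hP hP' hPQ)
  have h2 := resultant_eq_prod_eval (P.map (polyBar F)) (Q.map (polyBar F)) Q.natDegree
    natDegree_map_le (IsAlgClosed.splits _)
  rw [natDegree_map_eq_of_injective polyBar_injective, resultant_map_map,
    leadingCoeff_map_of_injective polyBar_injective] at h2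
  have hcard := card_roots_map_polyBar P
  obtain ⟨R, hR⟩ := Multiset.exists_cons_of_mem ((mem_roots_map_polyBar hP.ne_zero).2 hα)
  have hle : ∀ β ∈ R, absBar F (evalBar Q β) ≤ qr F (logHeight Q) := by
    intro β hβ
    rw [← height_eq hQ0]
    refine absBar_evalBar_le Q (absBar_root_le_one hP.ne_zero hlead ?_)
    rw [← mem_roots_map_polyBar hP.ne_zero, hR]
    exact Multiset.mem_cons_of_mem hβ
  have hprod : absBar F ((R.map (Q.map (polyBar F)).eval).prod) ≤ qr F (logHeight Q) := by
    rw [hR, Multiset.card_cons] at hcard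
    have hcases : R.card = 0 ∨ R.card = 1 := by lia
    rcases hcases with h | h
    · rw [Multiset.card_eq_zero.1 h]
      simpa using one_le_qr (F := F) (Nat.cast_nonneg (logHeight Q))
    · obtain ⟨β, rfl⟩ := Multiset.card_eq_one.1 h
      rw [Multiset.map_singleton, Multiset.prod_singleton, ← evalBar_eq_eval_map]
      exact hle β (by simp)
  rw [h2, hR, Multiset.map_cons, Multiset.prod_cons, map_mul, map_mul, map_pow, hH, qr_pow,
    ← evalBar_eq_eval_map] at h1
  refine h1.trans ?_
  rw [qr_add, mul_assoc]
  refine mul_le_mul_of_nonneg_left ?_ (qr_pos F _).le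
  rw [mul_comm]
  exact mul_le_mul_of_nonneg_right hprod ((absBar F).nonneg _)

end Roots

/-! ### Computing both exponents from a dense sequence of good approximations. -/

section Exponents

variable {F : Type*} [Field F] [Fintype F]

/-- A sequence of minimal polynomials `P k` of degree one or two which take very small values at
`ξ`: the value is `q ^ (-v k)`, and the value of the derivative is `q ^ b k`. -/
structure IsApproxSeq (ξ : F⸨X⸩) (P : ℕ → F[X][X]) (b v : ℕ → ℕ) : Prop where
  absL_le_one : absL F ξ ≤ 1
  natDegree_pos : ∀ k, 0 < (P k).natDegree
  natDegree_le_two : ∀ k, (P k).natDegree ≤ 2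
  irreducible : ∀ k, Irreducible (P k)
  isPrimitive : ∀ k, (P k).IsPrimitive
  monic_leadingCoeff : ∀ k, (P k).leadingCoeff.Monic
  natDegree_leadingCoeff : ∀ k, (P k).leadingCoeff.natDegree = logHeight (P k)
  absL_evalL : ∀ k, absL F (evalL (P k) ξ) = qr F (-(v k : ℝ))
  absL_evalL_derivative : ∀ k, absL F (evalL (derivative (P k)) ξ) = qr F (b k)
  logHeight_lt : ∀ k, logHeight (P k) < v k

variable {ξ : F⸨X⸩} {P : ℕ → F[X][X]} {b v : ℕ → ℕ}

theorem IsApproxSeq.exists_closest_root (hs : IsApproxSeq ξ P b v) (k : ℕ) :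
    ∃ α, evalBar (P k) α = 0 ∧
      absBar F (algebraMap F⸨X⸩ (AlgebraicClosure F⸨X⸩) ξ - α) = qr F (-((v k : ℝ) + b k)) ∧
      ∀ β, evalBar (P k) β = 0 →
        qr F (-((v k : ℝ) + b k)) ≤ absBar F (algebraMap F⸨X⸩ (AlgebraicClosure F⸨X⸩) ξ - β) := by
  refine FqLaurent.exists_closest_root (hs.natDegree_pos k) (hs.natDegree_le_two k)
    (hs.natDegree_leadingCoeff k) ?_ ?_ ?_
  · rw [absBar_evalBar_algebraMap, hs.absL_evalL]
  · rw [absBar_evalBar_algebraMap, hs.absL_evalL_derivative]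
  · have : (logHeight (P k) : ℝ) < v k := by exact_mod_cast hs.logHeight_lt k
    have : (0 : ℝ) ≤ b k := Nat.cast_nonneg _
    linarith

/-- The growth conditions on a sequence of approximations under which every polynomial of degree
at most `d` which is not in the sequence has a comparatively large value at `ξ`. -/
structure IsDense (d : ℕ) (K : ℝ) (P : ℕ → F[X][X]) (v : ℕ → ℕ) : Prop where
  tendsto : Tendsto (fun k => (logHeight (P k) : ℝ)) atTop atTop
  le_mul : ∀ k, (logHeight (P (k + 1)) : ℝ) ≤ K * v k
  mul_le : ∀ k, (2 * d + 1) * (logHeight (P k) : ℝ) ≤ v k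
  nonneg : 0 ≤ K

/-- Let `α` be the root of `P k` closest to `ξ`. The resultant bounds `|Q(α)|` below, while `|Q(ξ) -
Q(α)|` is at most the height of `Q` times `|ξ - α|`. Once `v k` is large enough the second is the
smaller, and `Q(ξ)` inherits the lower bound. Taking the first such `k` keeps the height of `P k`
linear in that of `Q`. -/
theorem IsApproxSeq.le_absL_evalL_of_irreducible (hs : IsApproxSeq ξ P b v) {d : ℕ} {K : ℝ}
    (hd : IsDense d K P v) {Q : F[X][X]} (hQ : Irreducible Q) (hQd : Q.natDegree ≤ d) :
    (∃ k, Associated (P k) Q) ∨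
      qr F (-((1 + 4 * d * K) * logHeight Q + d * logHeight (P 0))) ≤ absL F (evalL Q ξ) := by
  -- One copy of `logHeight Q` comes from the resultant, the other from the bound on `Q(ξ) - Q(α)`.
  have hex : ∃ k, 2 * (logHeight Q : ℝ) + d * logHeight (P k) < v k := by
    obtain ⟨k, hk⟩ := (hd.tendsto.eventually_gt_atTop (2 * (logHeight Q : ℝ))).exists
    refine ⟨k, ?_⟩
    have h1 := hd.mul_le k
    have h2 : (0 : ℝ) ≤ d * logHeight (P k) := by positivity
    linarith
  classical
  obtain ⟨k, hk, hmin⟩ : ∃ k, 2 * (logHeight Q : ℝ) + d * logHeight (P k) < v k ∧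
      ∀ j < k, ¬ 2 * (logHeight Q : ℝ) + d * logHeight (P j) < v j :=
    ⟨Nat.find hex, Nat.find_spec hex, fun j hj => Nat.find_min hex hj⟩
  by_cases hass : Associated (P k) Q
  · exact Or.inl ⟨k, hass⟩
  right
  have hndvd : ¬ P k ∣ Q := fun h =>
    hass ((hs.irreducible k).associated_of_dvd hQ h)
  obtain ⟨α, hα, hdist, -⟩ := hs.exists_closest_root k
  have h1 := one_le_mul_absBar_evalBar (hs.irreducible k) (hs.isPrimitive k)
    (hs.natDegree_le_two k) (hs.natDegree_leadingCoeff k) hndvd hα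
  have hα1 := absBar_root_le_one (hs.irreducible k).ne_zero (hs.natDegree_leadingCoeff k) hα
  have hx1 : absBar F (algebraMap F⸨X⸩ (AlgebraicClosure F⸨X⸩) ξ) ≤ 1 := by
    rw [absBar_algebraMap]
    exact hs.absL_le_one
  have h2 := absBar_evalBar_sub_le Q hα1 hx1
  rw [absBar_sub_comm α, hdist, height_eq hQ.ne_zero, ← qr_add] at h2
  have h3 := isNonarchimedean_absBar (evalBar Q (algebraMap F⸨X⸩ (AlgebraicClosure F⸨X⸩) ξ))
    (evalBar Q α - evalBar Q (algebraMap F⸨X⸩ (AlgebraicClosure F⸨X⸩) ξ))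
  rw [add_sub_cancel, absBar_evalBar_algebraMap] at h3
  have hb0 : (0 : ℝ) ≤ b k := Nat.cast_nonneg _
  have hdk : (Q.natDegree : ℝ) * logHeight (P k) ≤ d * logHeight (P k) := by
    have : (Q.natDegree : ℝ) ≤ d := by exact_mod_cast hQd
    gcongr
  have h4 : qr F (-(d * logHeight (P k) + logHeight Q)) ≤ absBar F (evalBar Q α) := by
    rw [← mul_le_mul_iff_right₀ (qr_pos F (Q.natDegree * logHeight (P k) + logHeight Q))]
    refine le_trans ?_ h1
    rw [← qr_add, ← qr_zero F, qr_le_qr]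
    linarith
  have h5 : qr F (-(d * logHeight (P k) + logHeight Q)) ≤ absL F (evalL Q ξ) := by
    rcases le_max_iff.1 (h4.trans h3) with h | h
    · exact h
    · have := h.trans h2
      rw [qr_le_qr] at this
      linarith
  refine le_trans (qr_le_qr.2 ?_) h5
  rcases Nat.eq_zero_or_pos k with rfl | hk0
  · have : (0 : ℝ) ≤ 4 * d * K * logHeight Q := by
      have := hd.nonneg
      positivity
    linarith
  · obtain ⟨j, rfl⟩ : ∃ j, k = j + 1 := ⟨k - 1, by lia⟩
    have h6 := not_lt.1 (hmin j (by lia))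
    have h7 := hd.mul_le j
    -- Minimality of `k = j + 1` gives `v j ≤ 2 * logHeight Q + d * logHeight (P j)`, and the last
    -- term is at most `v j / 2` by `IsDense.mul_le`.
    have h8 : (v j : ℝ) ≤ 4 * logHeight Q := by
      have : (0 : ℝ) ≤ logHeight (P j) := Nat.cast_nonneg _
      linarith
    have h9 : (logHeight (P (j + 1)) : ℝ) ≤ K * (4 * logHeight Q) :=
      (hd.le_mul j).trans (mul_le_mul_of_nonneg_left h8 hd.nonneg)
    have h10 : (d : ℝ) * logHeight (P (j + 1)) ≤ d * (K * (4 * logHeight Q)) := by gcongr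
    have h11 : (0 : ℝ) ≤ d * logHeight (P 0) := by positivity
    linarith

theorem evalL_mul (P Q : F[X][X]) (ξ : F⸨X⸩) : evalL (P * Q) ξ = evalL P ξ * evalL Q ξ :=
  eval₂_mul _ _

/-- Values multiply and logarithmic heights add over a factorization. The constant `c` is lost once
per nonconstant factor, hence at most `Q.natDegree` times. -/
theorem le_absL_evalL_of_forall_irreducible {d : ℕ} {w c : ℝ} (hw : 0 ≤ w) (hc : 0 ≤ c)
    (h : ∀ Q : F[X][X], Irreducible Q → 0 < Q.natDegree → Q.natDegree ≤ d →
      qr F (-(w * logHeight Q + c)) ≤ absL F (evalL Q ξ))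
    {Q : F[X][X]} (hQ : Q ≠ 0) (hQd : Q.natDegree ≤ d) :
    qr F (-(w * logHeight Q + c * Q.natDegree)) ≤ absL F (evalL Q ξ) := by
  have hconst : ∀ Q : F[X][X], Q ≠ 0 → Q.natDegree = 0 →
      qr F (-(w * logHeight Q + c * Q.natDegree)) ≤ absL F (evalL Q ξ) := by
    intro Q hQ hQ0
    rw [eq_C_of_natDegree_eq_zero hQ0] at hQ ⊢
    rw [evalL, eval₂_C]
    refine le_trans ?_ (one_le_absL_ofPoly (C_ne_zero.1 hQ))
    rw [← qr_zero F, qr_le_qr]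
    have : 0 ≤ w * (logHeight (C (Q.coeff 0)) : ℝ) + c * ((C (Q.coeff 0)).natDegree : ℝ) := by
      positivity
    linarith
  induction Q using WfDvdMonoid.induction_on_irreducible with
  | zero => exact absurd rfl hQ
  | unit u hu => exact hconst u hQ (natDegree_eq_zero_of_isUnit hu)
  | mul a i ha hi ih =>
    rw [natDegree_mul hi.ne_zero ha] at hQd
    rw [natDegree_mul hi.ne_zero ha, logHeight_mul hi.ne_zero ha, evalL_mul, map_mul]
    have h1 := ih ha (by lia)
    have h2 : qr F (-(w * logHeight i + c * i.natDegree)) ≤ absL F (evalL i ξ) := by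
      rcases Nat.eq_zero_or_pos i.natDegree with h0 | h0
      · exact hconst i hi.ne_zero h0
      · refine le_trans (qr_le_qr.2 ?_) (h i hi h0 (by lia))
        have : (1 : ℝ) ≤ i.natDegree := by exact_mod_cast h0
        nlinarith
    refine le_trans (le_of_eq ?_) (mul_le_mul h2 h1 (qr_pos F _).le ((absL F).nonneg _))
    rw [← qr_add]
    push_cast
    congr 1
    ring

/-- The `P k` themselves give the lower bound. For the upper bound, `hw` says that irreducible
polynomials outside the sequence do no better than exponent `w`. -/
theorem IsApproxSeq.wExp_eq (hs : IsApproxSeq ξ P b v) {d : ℕ} {K w : ℝ} (hd : IsDense d K P v)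
    (hw : 1 + 4 * d * K ≤ w)
    (hlow : ∀ w' < w, ∃ᶠ k in atTop, w' * logHeight (P k) < v k)
    (hupp : ∀ w' > w, ∀ᶠ k in atTop, (v k : ℝ) < w' * logHeight (P k))
    {n : ℕ} (hn : 2 ≤ n) (hnd : n ≤ d) : wExp n ξ = w := by
  have hκ : 0 ≤ 4 * d * K := by
    have := hd.nonneg
    positivity
  refine le_antisymm (iSup₂_le fun w' hw' => ?_) ?_
  · rw [EReal.coe_le_coe_iff]
    by_contra! hlt
    obtain ⟨w'', h1, h2⟩ := exists_between hlt
    obtain ⟨N, hN⟩ := eventually_atTop.1 (hupp w'' h1)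
    -- The sum absorbs the finitely many `k < N` for which the exponent `w''` may fail.
    let c : ℝ := d * logHeight (P 0) + ∑ j ∈ Finset.range N, (v j : ℝ)
    have hc : 0 ≤ c := by positivity
    have hv : ∀ k, (v k : ℝ) ≤ w'' * logHeight (P k) + c := by
      intro k
      by_cases hk : N ≤ k
      · linarith [hN k hk]
      · have h3 : (v k : ℝ) ≤ ∑ j ∈ Finset.range N, (v j : ℝ) :=
          Finset.single_le_sum (f := fun j => (v j : ℝ)) (fun _ _ => Nat.cast_nonneg _)
            (Finset.mem_range.2 (by lia))
        have h4 : 0 ≤ w'' * (logHeight (P k) : ℝ) :=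
          mul_nonneg (by linarith) (Nat.cast_nonneg _)
        have h5 : (0 : ℝ) ≤ d * logHeight (P 0) := by positivity
        simp only [c]
        linarith
    have hirr : ∀ Q : F[X][X], Irreducible Q → 0 < Q.natDegree → Q.natDegree ≤ d →
        qr F (-(w'' * logHeight Q + c)) ≤ absL F (evalL Q ξ) := by
      intro Q hQ _ hQd
      rcases hs.le_absL_evalL_of_irreducible hd hQ hQd with ⟨k, u, rfl⟩ | h
      · have hu : absL F (evalL (u : F[X][X]) ξ) = 1 := by
          obtain ⟨r, hr, hru⟩ := Polynomial.isUnit_iff.1 u.isUnit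
          rw [← hru, evalL, eval₂_C, absL_ofPoly hr.ne_zero, natDegree_eq_zero_of_isUnit hr,
            Nat.cast_zero, qr_zero]
        rw [evalL_mul, map_mul, hu, mul_one, hs.absL_evalL, qr_le_qr,
          ← logHeight_eq_of_associated ⟨u, rfl⟩]
        linarith [hv k]
      · refine le_trans (qr_le_qr.2 ?_) h
        have h3 : (1 + 4 * d * K) * (logHeight Q : ℝ) ≤ w'' * logHeight Q := by
          gcongr
          linarith
        have h4 : (0 : ℝ) ≤ ∑ j ∈ Finset.range N, (v j : ℝ) := by positivity
        simp only [c]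
        linarith
    refine hw' ((finite_logHeight_le (F := F) n ⌈c * d / (w' - w'')⌉₊).subset ?_)
    rintro Q ⟨hQn, hQ0, hQ1⟩
    have hQ : Q ≠ 0 := by
      rintro rfl
      rw [evalL, eval₂_zero, map_zero] at hQ0
      exact lt_irrefl _ hQ0
    refine ⟨hQn, ?_⟩
    have h3 := (le_absL_evalL_of_forall_irreducible (by linarith) hc hirr hQ
      (hQn.trans hnd)).trans hQ1
    rw [height_eq hQ, qr_rpow, qr_le_qr] at h3
    have h4 : c * (Q.natDegree : ℝ) ≤ c * d := by
      have : (Q.natDegree : ℝ) ≤ d := by exact_mod_cast hQn.trans hnd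
      gcongr
    have h5 : (logHeight Q : ℝ) ≤ c * d / (w' - w'') := by
      rw [le_div_iff₀ (by linarith)]
      linarith
    exact_mod_cast h5.trans (Nat.le_ceil _)
  · refine EReal.ge_of_forall_gt_iff_ge.1 fun w' hw' => ?_
    rw [EReal.coe_lt_coe_iff] at hw'
    refine le_iSup₂_of_le w' (fun hfin => ?_) le_rfl
    obtain ⟨B, hB⟩ := (hfin.image logHeight).bddAbove
    obtain ⟨k, hk, hkB⟩ :=
      ((hlow w' hw').and_eventually (hd.tendsto.eventually_gt_atTop (B : ℝ))).exists
    have hmem : logHeight (P k) ≤ B := by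
      refine hB ⟨P k, ⟨(hs.natDegree_le_two k).trans hn, ?_, ?_⟩, rfl⟩
      · rw [hs.absL_evalL]
        exact qr_pos F _
      · rw [hs.absL_evalL, height_eq (hs.irreducible k).ne_zero, qr_rpow, qr_le_qr]
        linarith
    have : (logHeight (P k) : ℝ) ≤ B := by exact_mod_cast hmem
    linarith

/-- For roots of the `P k` the distance to `ξ` is controlled by `exists_closest_root`. For a root of
any other `Q`, the value `|Q(ξ)|` is at most the height of `Q` times the distance, so the lower
bound on the value applies. -/
theorem IsApproxSeq.wStar_eq (hs : IsApproxSeq ξ P b v) {d : ℕ} {K w : ℝ} (hd : IsDense d K P v)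
    (hw : 1 + 4 * d * K ≤ w)
    (hlow : ∀ w' < w, ∃ᶠ k in atTop, (w' + 1) * logHeight (P k) < v k + b k)
    (hupp : ∀ w' > w, ∀ᶠ k in atTop, (v k : ℝ) + b k < (w' + 1) * logHeight (P k))
    {n : ℕ} (hn : 2 ≤ n) (hnd : n ≤ d) : wStar n ξ = w := by
  have hκ : 0 ≤ 4 * d * K := by
    have := hd.nonneg
    positivity
  refine le_antisymm (iSup₂_le fun w' hw' => ?_) ?_
  · rw [EReal.coe_le_coe_iff]
    by_contra! hlt
    obtain ⟨N, hN⟩ := eventually_atTop.1 (hupp w' hlt)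
    let c : ℝ := d * logHeight (P 0) / (w' - w) + ∑ j ∈ Finset.range N, (logHeight (P j) : ℝ)
    have hc1 : (0 : ℝ) ≤ d * logHeight (P 0) / (w' - w) :=
      div_nonneg (by positivity) (by linarith)
    have hc2 : (0 : ℝ) ≤ ∑ j ∈ Finset.range N, (logHeight (P j) : ℝ) := by positivity
    classical
    refine hw' ((((finite_logHeight_le (F := F) n ⌈c⌉₊).subset
      (Set.sep_subset _ fun Q => Q ≠ 0)).biUnion fun Q _ =>
        (Multiset.toFinset (Q.map (polyBar F)).roots).finite_toSet).subset ?_)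
    rintro α ⟨Q, hQ, hQn, hQ0, hQ1⟩
    have hQne := hQ.irreducible.ne_zero
    simp only [Set.mem_iUnion]
    refine ⟨Q, ⟨⟨hQn, ?_⟩, hQne⟩, ?_⟩
    swap
    · rw [Finset.mem_coe, Multiset.mem_toFinset, mem_roots_map_polyBar hQne]
      exact hQ.root
    rw [height_eq hQne, qr_rpow] at hQ1
    suffices h : (logHeight Q : ℝ) ≤ c by exact_mod_cast h.trans (Nat.le_ceil _)
    rcases hs.le_absL_evalL_of_irreducible hd hQ.irreducible (hQn.trans hnd) with ⟨k, hk⟩ | h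
    · have hroot : evalBar (P k) α = 0 := by
        obtain ⟨R, hR⟩ := hk.symm.dvd
        rw [hR, evalBar, eval₂_mul]
        have := hQ.root
        rw [evalBar] at this
        rw [this, zero_mul]
      obtain ⟨-, -, -, hfar⟩ := hs.exists_closest_root k
      have h1 := (hfar α hroot).trans hQ1
      rw [qr_le_qr, ← logHeight_eq_of_associated hk] at h1
      have hkN : k < N := by
        by_contra! hkN
        linarith [hN k hkN]
      rw [← logHeight_eq_of_associated hk]
      have h3 : (logHeight (P k) : ℝ) ≤ ∑ j ∈ Finset.range N, (logHeight (P j) : ℝ) :=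
        Finset.single_le_sum (f := fun j => (logHeight (P j) : ℝ)) (fun _ _ => Nat.cast_nonneg _)
          (Finset.mem_range.2 hkN)
      simp only [c]
      linarith
    · have hx1 : absBar F (algebraMap F⸨X⸩ (AlgebraicClosure F⸨X⸩) ξ) ≤ 1 := by
        rw [absBar_algebraMap]
        exact hs.absL_le_one
      have hle1 : absBar F (algebraMap F⸨X⸩ (AlgebraicClosure F⸨X⸩) ξ - α) ≤ 1 := by
        refine hQ1.trans ((qr_le_qr.2 ?_).trans (qr_zero F).le)
        exact mul_nonpos_of_nonneg_of_nonpos (Nat.cast_nonneg _) (by linarith)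
      have hα1 : absBar F α ≤ 1 := by
        have h1 := isNonarchimedean_absBar (algebraMap F⸨X⸩ (AlgebraicClosure F⸨X⸩) ξ)
          (α - algebraMap F⸨X⸩ (AlgebraicClosure F⸨X⸩) ξ)
        rw [add_sub_cancel, absBar_sub_comm α] at h1
        exact h1.trans (max_le hx1 hle1)
      have h1 := absBar_evalBar_sub_le Q hx1 hα1
      rw [hQ.root, sub_zero, absBar_evalBar_algebraMap, height_eq hQne] at h1
      have h2 := (h.trans h1).trans (mul_le_mul_of_nonneg_left hQ1 (qr_pos F _).le)
      rw [← qr_add, qr_le_qr] at h2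
      have h3 : (1 + 4 * d * K) * (logHeight Q : ℝ) ≤ w * logHeight Q := by
        gcongr
      have h5 : (logHeight Q : ℝ) ≤ d * logHeight (P 0) / (w' - w) := by
        rw [le_div_iff₀ (by linarith)]
        linarith
      simp only [c]
      linarith
  · refine EReal.ge_of_forall_gt_iff_ge.1 fun w' hw' => ?_
    rw [EReal.coe_lt_coe_iff] at hw'
    refine le_iSup₂_of_le w' (fun hfin => ?_) le_rfl
    choose α hα hdist _ using hs.exists_closest_root
    let x := algebraMap F⸨X⸩ (AlgebraicClosure F⸨X⸩) ξ
    -- If only finitely many `α` were admissible, the logarithms of their distances to `ξ` would be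
    -- bounded below, whereas those of the `α k` tend to `-∞`.
    obtain ⟨B, hB⟩ :=
      (hfin.image fun β => Real.logb (Fintype.card F) (absBar F (x - β))).bddBelow
    obtain ⟨k, hk, hkB⟩ :=
      ((hlow w' hw').and_eventually (hd.tendsto.eventually_gt_atTop (-B : ℝ))).exists
    have hpos : 0 < absBar F (x - α k) := by
      rw [hdist]
      exact qr_pos F _
    have hmem : B ≤ Real.logb (Fintype.card F) (absBar F (x - α k)) := by
      refine hB ⟨α k, ⟨P k, ⟨hs.natDegree_pos k, hs.irreducible k, hs.isPrimitive k,
        hs.monic_leadingCoeff k, hα k⟩, (hs.natDegree_le_two k).trans hn, hpos, ?_⟩, rfl⟩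
      rw [hdist, height_eq (hs.irreducible k).ne_zero, qr_rpow, qr_le_qr]
      linarith
    rw [Real.le_logb_iff_rpow_le (one_lt_q F) hpos] at hmem
    have h1 : qr F B ≤ qr F (-((v k : ℝ) + b k)) := hmem.trans (hdist k).le
    rw [qr_le_qr] at h1
    have h2 : (logHeight (P k) : ℝ) < v k := by exact_mod_cast hs.logHeight_lt k
    have h3 : (0 : ℝ) ≤ b k := Nat.cast_nonneg _
    linarith

theorem IsApproxSeq.wExp_sub_wStar (hs : IsApproxSeq ξ P b v) {d : ℕ} {K C δ : ℝ}
    (hd : IsDense d K P v) (hδ : δ ≤ 1) (hlarge : ∀ k, (2 + 4 * d * K) * logHeight (P k) ≤ v k)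
    (hC : ∀ k, (v k : ℝ) ≤ C * logHeight (P k))
    (hb : Tendsto (fun k => (b k : ℝ) / logHeight (P k)) atTop (𝓝 (1 - δ)))
    {n : ℕ} (hn : 2 ≤ n) (hnd : n ≤ d) : wExp n ξ - wStar n ξ = (δ : EReal) := by
  have hpos : ∀ k, (0 : ℝ) < logHeight (P k) := by
    intro k
    rcases Nat.eq_zero_or_pos (logHeight (P k)) with h | h
    · have h1 := hC k
      have h2 := hs.logHeight_lt k
      rw [h, Nat.cast_zero, mul_zero] at h1
      have : v k ≤ 0 := by exact_mod_cast h1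
      lia
    · exact_mod_cast h
  let r : ℕ → ℝ := fun k => (v k : ℝ) / logHeight (P k)
  have hrC : ∀ k, r k ≤ C := fun k => (div_le_iff₀ (hpos k)).2 (hC k)
  have hrl : ∀ k, 2 + 4 * d * K ≤ r k := fun k => (le_div_iff₀ (hpos k)).2 (hlarge k)
  have hbdd : IsBoundedUnder (· ≤ ·) atTop r := isBoundedUnder_of ⟨C, hrC⟩
  have hcob : IsCoboundedUnder (· ≤ ·) atTop r :=
    IsBoundedUnder.isCoboundedUnder_le (isBoundedUnder_of ⟨2 + 4 * d * K, hrl⟩)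
  let w : ℝ := limsup r atTop
  have hlow : ∀ w' < w, ∃ᶠ k in atTop, w' < r k := fun w' h =>
    frequently_lt_of_lt_limsup hcob h
  have hupp : ∀ w' > w, ∀ᶠ k in atTop, r k < w' := fun w' h =>
    eventually_lt_of_limsup_lt h hbdd
  -- The constant is `2`, not `1`, because `wStar_eq` is applied to `w - δ` with `δ ≤ 1`.
  have hw : 2 + 4 * d * K ≤ w := by
    by_contra! h
    obtain ⟨k, hk⟩ := (hupp _ h).exists
    exact absurd (hrl k) (not_le.2 hk)
  have h1 : wExp n ξ = w := by
    refine hs.wExp_eq hd (by linarith) (fun w' h => ?_) (fun w' h => ?_) hn hnd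
    · exact (hlow w' h).mono fun k hk => (lt_div_iff₀ (hpos k)).1 hk
    · exact (hupp w' h).mono fun k hk => (div_lt_iff₀ (hpos k)).1 hk
  have h2 : wStar n ξ = ((w - δ : ℝ) : EReal) := by
    refine hs.wStar_eq hd (by linarith) (fun w' h => ?_) (fun w' h => ?_) hn hnd
    -- Half of the gap is spent on `v k / h k` and half on `b k / h k`, where `h k` is `logHeight (P
    -- k)`.
    · let ε := (w - δ - w') / 2
      have hε : 0 < ε := by simp only [ε]; linarith
      refine ((hlow (w - ε) (by linarith)).and_eventually
        (hb.eventually_const_lt (show 1 - δ - ε < 1 - δ by linarith))).mono fun k hk => ?_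
      have h3 := (lt_div_iff₀ (hpos k)).1 hk.1
      have h4 := (lt_div_iff₀ (hpos k)).1 hk.2
      have h5 : (w' + 1) * (logHeight (P k) : ℝ)
          = (w - ε) * logHeight (P k) + (1 - δ - ε) * logHeight (P k) := by
        simp only [ε]
        ring
      linarith
    · let ε := (w' - (w - δ)) / 2
      have hε : 0 < ε := by simp only [ε]; linarith
      refine ((hupp (w + ε) (by linarith)).and
        (hb.eventually_lt_const (show 1 - δ < 1 - δ + ε by linarith))).mono fun k hk => ?_
      have h3 := (div_lt_iff₀ (hpos k)).1 hk.1
      have h4 := (div_lt_iff₀ (hpos k)).1 hk.2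
      have h5 : (w' + 1) * (logHeight (P k) : ℝ)
          = (w + ε) * logHeight (P k) + (1 - δ + ε) * logHeight (P k) := by
        simp only [ε]
        ring
      linarith
  rw [h1, h2, ← EReal.coe_sub]
  congr 1
  ring

end Exponents

/-! ### Continued fractions over `F[X]`: existence and uniqueness. -/

section ContinuedFractions

/-- The solution with initial values `x`, `y` of the recurrence `u (n + 2) = a n * u (n + 1) + u n`
satisfied by the numerators and denominators of the convergents of a continued fraction. -/
def contRec {R : Type*} [Semiring R] (a : ℕ → R) (x y : R) : ℕ → R
  | 0 => x
  | 1 => y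
  | n + 2 => a n * contRec a x y (n + 1) + contRec a x y n

variable {F : Type*} [Field F] [Fintype F]

/-- The numerators of the convergents of `[0; a 0, a 1, …]`, starting with `1, 0`. -/
def cfNum (a : ℕ → F[X]) : ℕ → F[X] := contRec a 1 0

/-- The denominators of the convergents of `[0; a 0, a 1, …]`, starting with `0, 1`. -/
def cfDen (a : ℕ → F[X]) : ℕ → F[X] := contRec a 0 1

/-- The sum of the degrees of the first `n` partial quotients. -/
def cfDeg (a : ℕ → F[X]) (n : ℕ) : ℕ := ∑ i ∈ Finset.range n, (a i).natDegree

theorem cfNum_add_two (a : ℕ → F[X]) (n : ℕ) :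
    cfNum a (n + 2) = a n * cfNum a (n + 1) + cfNum a n := rfl

theorem cfDen_add_two (a : ℕ → F[X]) (n : ℕ) :
    cfDen a (n + 2) = a n * cfDen a (n + 1) + cfDen a n := rfl

theorem cfDeg_succ (a : ℕ → F[X]) (n : ℕ) : cfDeg a (n + 1) = cfDeg a n + (a n).natDegree :=
  Finset.sum_range_succ _ _

theorem cfNum_mul_cfDen_sub (a : ℕ → F[X]) (n : ℕ) :
    cfNum a n * cfDen a (n + 1) - cfNum a (n + 1) * cfDen a n = (-1) ^ n := by
  induction n with
  | zero => simp [cfNum, cfDen, contRec]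
  | succ n ih =>
    rw [cfNum_add_two, cfDen_add_two, pow_succ, ← ih]
    ring

/-- Sequences of partial quotients, normalized to be monic. -/
structure IsQuotSeq (a : ℕ → F[X]) : Prop where
  monic : ∀ n, (a n).Monic
  natDegree_pos : ∀ n, 0 < (a n).natDegree

variable {a : ℕ → F[X]}

theorem IsQuotSeq.cfDeg_lt_succ (ha : IsQuotSeq a) (n : ℕ) : cfDeg a n < cfDeg a (n + 1) := by
  rw [cfDeg_succ]
  have := ha.natDegree_pos n
  lia

theorem IsQuotSeq.strictMono_cfDeg (ha : IsQuotSeq a) : StrictMono (cfDeg a) :=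
  strictMono_nat_of_lt_succ ha.cfDeg_lt_succ

theorem IsQuotSeq.monic_cfDen_and (ha : IsQuotSeq a) (n : ℕ) :
    (cfDen a (n + 1)).Monic ∧ (cfDen a (n + 1)).natDegree = cfDeg a n ∧
      (cfDen a n).degree < (cfDen a (n + 1)).degree := by
  induction n with
  | zero => simp [cfDen, contRec, cfDeg]
  | succ n ih =>
    obtain ⟨h1, h2, h3⟩ := ih
    have h4 : (cfDen a (n + 1)).degree < (a n * cfDen a (n + 1)).degree := by
      rw [mul_comm, degree_mul, degree_eq_natDegree h1.ne_zero,
        degree_eq_natDegree (ha.monic n).ne_zero]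
      have := ha.natDegree_pos n
      norm_cast
      lia
    have h5 := h3.trans h4
    have h6 := (ha.monic n).mul h1
    rw [cfDen_add_two]
    refine ⟨h6.add_of_left h5, ?_, ?_⟩
    · rw [natDegree_add_eq_left_of_degree_lt h5, (ha.monic n).natDegree_mul h1, h2, cfDeg_succ,
        add_comm]
    · rwa [degree_add_eq_left_of_degree_lt h5]

theorem IsQuotSeq.monic_cfDen (ha : IsQuotSeq a) (n : ℕ) : (cfDen a (n + 1)).Monic :=
  (ha.monic_cfDen_and n).1

theorem IsQuotSeq.natDegree_cfDen (ha : IsQuotSeq a) (n : ℕ) :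
    (cfDen a (n + 1)).natDegree = cfDeg a n :=
  (ha.monic_cfDen_and n).2.1

theorem IsQuotSeq.natDegree_cfNum_le (ha : IsQuotSeq a) (n : ℕ) :
    (cfNum a (n + 1)).natDegree ≤ cfDeg a n := by
  induction n using Nat.twoStepInduction with
  | zero => simp [cfNum, contRec]
  | one => simp [cfNum, contRec]
  | more n ih1 ih2 =>
    rw [cfNum_add_two]
    refine natDegree_add_le_of_degree_le (natDegree_mul_le.trans ?_) ?_
    · rw [cfDeg_succ]
      lia
    · have := ha.strictMono_cfDeg (show n < n + 2 by lia)
      lia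

/-- The difference `q ξ - p` for the convergents `p / q` of a continued fraction. -/
def cfErr (a : ℕ → F[X]) (ξ : F⸨X⸩) (n : ℕ) : F⸨X⸩ :=
  ofPoly F (cfDen a n) * ξ - ofPoly F (cfNum a n)

theorem cfErr_add_two (a : ℕ → F[X]) (ξ : F⸨X⸩) (n : ℕ) :
    cfErr a ξ (n + 2) = ofPoly F (a n) * cfErr a ξ (n + 1) + cfErr a ξ n := by
  simp only [cfErr, cfDen_add_two, cfNum_add_two, map_add, map_mul]
  ring

/-- `ξ` is the value of the continued fraction `[0; a 0, a 1, …]`. -/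
def IsCF (a : ℕ → F[X]) (ξ : F⸨X⸩) : Prop := ∀ n, absL F (cfErr a ξ n) = qr F (-(cfDeg a n : ℝ))

theorem IsQuotSeq.absL_cfDen (ha : IsQuotSeq a) (n : ℕ) :
    absL F (ofPoly F (cfDen a (n + 1))) = qr F (cfDeg a n) := by
  rw [absL_ofPoly (ha.monic_cfDen n).ne_zero, ha.natDegree_cfDen]

/-- Consecutive convergents differ by `±1` over the product of their denominators. These differences
strictly decrease in absolute value, so in an ultrametric sum the first one dominates; this gives
exact distances and not mere bounds. -/
theorem IsQuotSeq.exists_isCF (ha : IsQuotSeq a) : ∃ ξ, IsCF a ξ := by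
  have hne : ∀ n, ofPoly F (cfDen a (n + 1)) ≠ 0 := fun n h =>
    (ha.monic_cfDen n).ne_zero ((map_eq_zero_iff _ ofPoly_injective).1 h)
  let s : ℕ → F⸨X⸩ := fun n => ofPoly F (cfNum a (n + 1)) / ofPoly F (cfDen a (n + 1))
  let r : ℕ → ℝ := fun n => qr F (-((cfDeg a n : ℝ) + cfDeg a (n + 1)))
  have hr : StrictAnti r := by
    refine strictAnti_nat_of_succ_lt fun n => qr_lt_qr.2 ?_
    have h1 : (cfDeg a n : ℝ) < cfDeg a (n + 1) := by exact_mod_cast ha.cfDeg_lt_succ n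
    have h2 : (cfDeg a (n + 1) : ℝ) < cfDeg a (n + 2) := by
      exact_mod_cast ha.cfDeg_lt_succ (n + 1)
    linarith
  have hstep : ∀ n, absL F (s (n + 1) - s n) = r n := by
    intro n
    have h1 := congrArg (ofPoly F) (cfNum_mul_cfDen_sub a (n + 1))
    simp only [map_sub, map_mul, map_pow, map_neg, map_one] at h1
    have h2 : s (n + 1) - s n = -((-1) ^ (n + 1)) /
        (ofPoly F (cfDen a (n + 1)) * ofPoly F (cfDen a (n + 2))) := by
      rw [← h1]
      simp only [s]
      have := hne n
      have := hne (n + 1)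
      field_simp
      ring
    rw [h2, map_div₀, map_mul, ha.absL_cfDen, ha.absL_cfDen, AbsoluteValue.map_neg, map_pow,
      AbsoluteValue.map_neg, map_one, one_pow, ← qr_add, ← qr_zero F, ← qr_sub, zero_sub]
  have hgt : ∀ n k, absL F (s (n + 1 + k) - s n) = r n := by
    intro n k
    induction k with
    | zero => exact hstep n
    | succ k ih =>
      have h1 : s (n + 1 + (k + 1)) - s n
          = (s (n + 1 + k) - s n) + (s (n + 1 + k + 1) - s (n + 1 + k)) := by
        rw [← add_assoc]
        ring
      rw [h1, isNonarchimedean_absL.add_eq_left_of_lt, ih]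
      rw [ih, hstep]
      exact hr (by lia)
  have hlim : ∀ ε > 0, ∃ N, r N < ε := by
    intro ε hε
    obtain ⟨N, hN⟩ := exists_pow_lt_of_lt_one hε (inv_lt_one_of_one_lt₀ (one_lt_q F))
    refine ⟨N, lt_of_le_of_lt ?_ hN⟩
    have h1 : ((Fintype.card F : ℝ)⁻¹) ^ N = qr F (-(N : ℝ)) := by
      rw [qr, Real.rpow_neg (zero_lt_one.trans (one_lt_q F)).le, Real.rpow_natCast, inv_pow]
    rw [h1, qr_le_qr]
    have h2 : (N : ℝ) ≤ cfDeg a N := by exact_mod_cast ha.strictMono_cfDeg.le_apply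
    have h3 : (0 : ℝ) ≤ cfDeg a (N + 1) := Nat.cast_nonneg _
    linarith
  have hle : ∀ n m, n ≤ m → absL F (s m - s n) ≤ r n := by
    intro n m hnm
    rcases hnm.eq_or_lt with rfl | h
    · rw [sub_self, map_zero]
      exact (qr_pos F _).le
    · obtain ⟨k, rfl⟩ := Nat.exists_eq_add_of_le (Nat.succ_le_of_lt h)
      exact (hgt n k).le
  obtain ⟨ξ, hξ⟩ := complete_absL s fun ε hε => by
    obtain ⟨N, hN⟩ := hlim ε hε
    refine ⟨N, fun m hm n hn => lt_of_le_of_lt ?_ hN⟩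
    have h1 : s m - s n = (s m - s N) + (s N - s n) := by ring
    rw [h1]
    refine (absL_add_le_max _ _).trans (max_le (hle N m hm) ?_)
    rw [AbsoluteValue.map_sub]
    exact hle N n hn
  refine ⟨ξ, fun n => ?_⟩
  rcases n with _ | n
  · simp [cfErr, cfDen, cfNum, contRec, cfDeg, qr_zero]
  · obtain ⟨N, hN⟩ := hξ (r n) (qr_pos F _)
    have h1 := hN (n + 1 + N) (by lia)
    have h2 : absL F (ξ - s n) = r n := by
      have h3 : ξ - s n = (s (n + 1 + N) - s n) + (ξ - s (n + 1 + N)) := by ring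
      rw [h3, isNonarchimedean_absL.add_eq_left_of_lt, hgt]
      rwa [hgt, AbsoluteValue.map_sub]
    have h4 : cfErr a ξ (n + 1) = ofPoly F (cfDen a (n + 1)) * (ξ - s n) := by
      simp only [cfErr, s]
      rw [mul_sub, mul_div_cancel₀ _ (hne n)]
    rw [h4, map_mul, h2, ha.absL_cfDen, ← qr_add]
    congr 1
    ring

theorem IsCF.absL_le_one {ξ : F⸨X⸩} (hξ : IsCF a ξ) : absL F ξ ≤ 1 := by
  have h := hξ 1
  have h1 : cfErr a ξ 1 = ξ := by simp [cfErr, cfDen, cfNum, contRec]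
  rw [h1] at h
  rw [h]
  refine (qr_le_qr.2 ?_).trans (qr_zero F).le
  simp

/-- The errors determine the quotients: `a n` is the only polynomial making `a n * cfErr a ξ (n + 1)
+ cfErr a ξ n` smaller than `cfErr a ξ (n + 1)`, since distinct polynomials are at distance at least
one. -/
theorem IsCF.eq {a' : ℕ → F[X]} {ξ : F⸨X⸩} (ha : IsQuotSeq a) (ha' : IsQuotSeq a')
    (hξ : IsCF a ξ) (hξ' : IsCF a' ξ) : a = a' := by
  have key : ∀ n, (∀ i < n, a i = a' i) ∧ cfErr a ξ n = cfErr a' ξ n ∧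
      cfErr a ξ (n + 1) = cfErr a' ξ (n + 1) := by
    intro n
    induction n with
    | zero => simp [cfErr, cfDen, cfNum, contRec]
    | succ n ih =>
      obtain ⟨h1, h2, h3⟩ := ih
      have hn : a n = a' n := by
        by_contra hne
        have h4 : ofPoly F (a n - a' n) * cfErr a ξ (n + 1)
            = cfErr a ξ (n + 2) + -cfErr a' ξ (n + 2) := by
          rw [cfErr_add_two, cfErr_add_two, ← h2, ← h3, map_sub]
          ring
        have hlt : absL F (cfErr a ξ (n + 2)) < absL F (cfErr a ξ (n + 1)) := by
          rw [hξ, hξ, qr_lt_qr, neg_lt_neg_iff]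
          exact_mod_cast ha.cfDeg_lt_succ (n + 1)
        have hlt' : absL F (cfErr a' ξ (n + 2)) < absL F (cfErr a ξ (n + 1)) := by
          rw [h3, hξ', hξ', qr_lt_qr, neg_lt_neg_iff]
          exact_mod_cast ha'.cfDeg_lt_succ (n + 1)
        have h5 := congrArg (absL F) h4
        have h6 := isNonarchimedean_absL (cfErr a ξ (n + 2)) (-cfErr a' ξ (n + 2))
        rw [← h5, map_mul, AbsoluteValue.map_neg] at h6
        have h7 := h6.trans_lt (max_lt hlt hlt')
        exact absurd (le_mul_of_one_le_left ((absL F).nonneg _)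
          (one_le_absL_ofPoly (sub_ne_zero.2 hne))) (not_le.2 h7)
      refine ⟨fun i hi => ?_, h3, ?_⟩
      · rcases Nat.lt_succ_iff_lt_or_eq.1 hi with h | rfl
        · exact h1 i h
        · exact hn
      · rw [cfErr_add_two, cfErr_add_two, h2, h3, hn]
  exact funext fun n => (key (n + 1)).1 n (Nat.lt_succ_self n)

end ContinuedFractions

/-! ### Linear polynomials of convergents as approximations. -/

section Convergents

variable {F : Type*} [Field F] [Fintype F] {a : ℕ → F[X]}

theorem irreducible_of_isPrimitive {P : F[X][X]} (hP : P.IsPrimitive) (h0 : 0 < P.natDegree)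
    (h2 : P.natDegree ≤ 2)
    (h : ∀ f g : F[X][X], P = f * g → f.natDegree = 1 → g.natDegree = 1 → False) :
    Irreducible P := by
  have hconst : ∀ f g : F[X][X], P = f * g → f.natDegree = 0 → IsUnit f := by
    intro f g hfg hf
    rw [eq_C_of_natDegree_eq_zero hf] at hfg ⊢
    exact isUnit_C.2 (hP _ ⟨g, hfg⟩)
  refine ⟨fun hu => h0.ne' (natDegree_eq_zero_of_isUnit hu), fun f g hfg => ?_⟩
  have hne := ne_zero_of_natDegree_pos h0
  rw [hfg] at hne h0 h2
  rw [natDegree_mul (left_ne_zero_of_mul hne) (right_ne_zero_of_mul hne)] at h0 h2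
  by_cases hf : f.natDegree = 0
  · exact Or.inl (hconst f g hfg hf)
  by_cases hg : g.natDegree = 0
  · exact Or.inr (hconst g f (by rw [hfg, mul_comm]) hg)
  exact (h f g hfg (by lia) (by lia)).elim

/-- The linear polynomial `q X - p` for the convergents `p / q` of a continued fraction. -/
def cfLin (a : ℕ → F[X]) (n : ℕ) : F[X][X] := C (cfDen a n) * X - C (cfNum a n)

theorem evalL_cfLin (a : ℕ → F[X]) (n : ℕ) (ξ : F⸨X⸩) : evalL (cfLin a n) ξ = cfErr a ξ n := by
  simp [evalL, cfLin, cfErr, eval₂_sub, eval₂_mul]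

theorem evalL_derivative_cfLin (a : ℕ → F[X]) (n : ℕ) (ξ : F⸨X⸩) :
    evalL (derivative (cfLin a n)) ξ = ofPoly F (cfDen a n) := by
  simp [evalL, cfLin]

theorem cfLin_eq (a : ℕ → F[X]) (n : ℕ) :
    cfLin a n = C (cfDen a n) * X + C (-cfNum a n) := by
  rw [cfLin, C_neg, sub_eq_add_neg]

theorem IsQuotSeq.natDegree_cfLin (ha : IsQuotSeq a) (n : ℕ) :
    (cfLin a (n + 1)).natDegree = 1 := by
  rw [cfLin_eq, natDegree_linear (ha.monic_cfDen n).ne_zero]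

theorem IsQuotSeq.leadingCoeff_cfLin (ha : IsQuotSeq a) (n : ℕ) :
    (cfLin a (n + 1)).leadingCoeff = cfDen a (n + 1) := by
  rw [cfLin_eq, leadingCoeff_linear (ha.monic_cfDen n).ne_zero]

theorem IsQuotSeq.logHeight_cfLin (ha : IsQuotSeq a) (n : ℕ) :
    logHeight (cfLin a (n + 1)) = cfDeg a n := by
  refine le_antisymm (Finset.sup_le fun i hi => ?_) ?_
  · rw [ha.natDegree_cfLin, Finset.mem_range] at hi
    rw [cfLin_eq]
    interval_cases i
    · simpa using ha.natDegree_cfNum_le n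
    · simpa using (ha.natDegree_cfDen n).le
  · rw [← ha.natDegree_cfDen, ← ha.leadingCoeff_cfLin]
    exact natDegree_coeff_le_logHeight _ _

/-- A common divisor of `p` and `q` divides the determinant `±1` of two consecutive convergents. -/
theorem isPrimitive_cfLin (a : ℕ → F[X]) (n : ℕ) : (cfLin a n).IsPrimitive := by
  intro r hr
  rw [C_dvd_iff_dvd_coeff] at hr
  have h0 := hr 0
  have h1 := hr 1
  simp only [cfLin_eq, coeff_add, coeff_C_mul, coeff_X_zero, coeff_C_zero, mul_zero, zero_add,
    coeff_X_one, mul_one, coeff_C_succ, add_zero, dvd_neg] at h0 h1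
  refine isUnit_of_dvd_unit ?_ (isUnit_one.neg.pow n)
  rw [← cfNum_mul_cfDen_sub a n]
  exact dvd_sub (h0.mul_right _) (h1.mul_left _)

theorem IsQuotSeq.irreducible_cfLin (ha : IsQuotSeq a) (n : ℕ) :
    Irreducible (cfLin a (n + 1)) := by
  have h1 := ha.natDegree_cfLin n
  refine irreducible_of_isPrimitive (isPrimitive_cfLin a _) (by lia) (by lia) ?_
  intro f g hfg hf hg
  have hne : cfLin a (n + 1) ≠ 0 := (isPrimitive_cfLin a _).ne_zero
  rw [hfg] at hne h1
  rw [natDegree_mul (left_ne_zero_of_mul hne) (right_ne_zero_of_mul hne)] at h1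
  lia

theorem IsCF.isApproxSeq_cfLin {ξ : F⸨X⸩} (ha : IsQuotSeq a) (hξ : IsCF a ξ) :
    IsApproxSeq ξ (fun k => cfLin a (k + 2)) (fun k => cfDeg a (k + 1))
      (fun k => cfDeg a (k + 2)) where
  absL_le_one := hξ.absL_le_one
  natDegree_pos k := by rw [ha.natDegree_cfLin]; exact one_pos
  natDegree_le_two k := by rw [ha.natDegree_cfLin]; exact one_le_two
  irreducible k := ha.irreducible_cfLin _
  isPrimitive k := isPrimitive_cfLin a _
  monic_leadingCoeff k := by rw [ha.leadingCoeff_cfLin]; exact ha.monic_cfDen _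
  natDegree_leadingCoeff k := by
    rw [ha.leadingCoeff_cfLin, ha.natDegree_cfDen, ha.logHeight_cfLin]
  absL_evalL k := by rw [evalL_cfLin, hξ]
  absL_evalL_derivative k := by rw [evalL_derivative_cfLin, ha.absL_cfDen]
  logHeight_lt k := by rw [ha.logHeight_cfLin]; exact ha.cfDeg_lt_succ _

end Convergents

/-! ### Quadratic polynomials of eventually constant continued fractions. -/

section Quadratics

variable {F : Type*} [Field F] [Fintype F] {a : ℕ → F[X]} {B : F[X]} {n : ℕ}

/-- The quadratic polynomial which vanishes at the continued fraction whose first `n - 1` partial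
quotients are those of `a`, and whose other partial quotients are all equal to `B`. -/
def cfQuad (a : ℕ → F[X]) (B : F[X]) (n : ℕ) : F[X][X] :=
  C B * cfLin a (n + 1) * cfLin a n + cfLin a n ^ 2 - cfLin a (n + 1) ^ 2

/-- The leading coefficient of `cfQuad a B n`. -/
def cfQuadLead (a : ℕ → F[X]) (B : F[X]) (n : ℕ) : F[X] :=
  B * cfDen a (n + 1) * cfDen a n + cfDen a n ^ 2 - cfDen a (n + 1) ^ 2

/-- The linear coefficient of `cfQuad a B n`. -/
def cfQuadMid (a : ℕ → F[X]) (B : F[X]) (n : ℕ) : F[X] :=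
  -(B * (cfDen a (n + 1) * cfNum a n + cfNum a (n + 1) * cfDen a n)
    + 2 * (cfDen a n * cfNum a n) - 2 * (cfDen a (n + 1) * cfNum a (n + 1)))

/-- The constant coefficient of `cfQuad a B n`. -/
def cfQuadConst (a : ℕ → F[X]) (B : F[X]) (n : ℕ) : F[X] :=
  B * cfNum a (n + 1) * cfNum a n + cfNum a n ^ 2 - cfNum a (n + 1) ^ 2

theorem cfQuad_eq (a : ℕ → F[X]) (B : F[X]) (n : ℕ) :
    cfQuad a B n = C (cfQuadLead a B n) * X ^ 2 + C (cfQuadMid a B n) * X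
      + C (cfQuadConst a B n) := by
  simp only [cfQuad, cfQuadLead, cfQuadMid, cfQuadConst, cfLin, map_add, map_sub, map_mul, map_neg,
    map_pow, map_ofNat]
  ring

/-- Because `B` has larger degree than the quotient just before it, the product term of `cfQuad a B
(n + 1)` dominates both squares. This fixes the height, which the leading coefficient attains. -/
theorem IsQuotSeq.natDegree_cfQuad_aux (ha : IsQuotSeq a) (hB : (a n).natDegree < B.natDegree) :
    2 * cfDeg a (n + 1) < B.natDegree + cfDeg a (n + 1) + cfDeg a n ∧
      2 * cfDeg a n < B.natDegree + cfDeg a (n + 1) + cfDeg a n := by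
  have := cfDeg_succ a n
  have := ha.natDegree_pos n
  lia

theorem IsQuotSeq.monic_cfQuadLead_and (ha : IsQuotSeq a) (hBm : B.Monic)
    (hB : (a n).natDegree < B.natDegree) :
    (cfQuadLead a B (n + 1)).Monic ∧
      (cfQuadLead a B (n + 1)).natDegree = B.natDegree + cfDeg a (n + 1) + cfDeg a n := by
  obtain ⟨h1, h2⟩ := ha.natDegree_cfQuad_aux hB
  have hm : (B * cfDen a (n + 2) * cfDen a (n + 1)).Monic :=
    (hBm.mul (ha.monic_cfDen _)).mul (ha.monic_cfDen _)
  have hd : (B * cfDen a (n + 2) * cfDen a (n + 1)).natDegree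
      = B.natDegree + cfDeg a (n + 1) + cfDeg a n := by
    rw [(hBm.mul (ha.monic_cfDen _)).natDegree_mul (ha.monic_cfDen _),
      hBm.natDegree_mul (ha.monic_cfDen _), ha.natDegree_cfDen, ha.natDegree_cfDen]
  have hlt : (cfDen a (n + 1) ^ 2 - cfDen a (n + 2) ^ 2).degree
      < (B * cfDen a (n + 2) * cfDen a (n + 1)).degree := by
    refine degree_lt_degree ?_
    rw [hd]
    refine (natDegree_sub_le _ _).trans_lt (max_lt ?_ ?_) <;>
      rwa [(ha.monic_cfDen _).natDegree_pow, ha.natDegree_cfDen]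
  rw [cfQuadLead, add_sub_assoc]
  exact ⟨hm.add_of_left hlt, by rw [natDegree_add_eq_left_of_degree_lt hlt, hd]⟩

theorem IsQuotSeq.natDegree_cfQuad (ha : IsQuotSeq a) (hBm : B.Monic)
    (hB : (a n).natDegree < B.natDegree) : (cfQuad a B (n + 1)).natDegree = 2 := by
  rw [cfQuad_eq, natDegree_quadratic (ha.monic_cfQuadLead_and hBm hB).1.ne_zero]

theorem IsQuotSeq.leadingCoeff_cfQuad (ha : IsQuotSeq a) (hBm : B.Monic)
    (hB : (a n).natDegree < B.natDegree) :
    (cfQuad a B (n + 1)).leadingCoeff = cfQuadLead a B (n + 1) := by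
  rw [cfQuad_eq, leadingCoeff_quadratic (ha.monic_cfQuadLead_and hBm hB).1.ne_zero]

theorem coeff_cfQuad (a : ℕ → F[X]) (B : F[X]) (n : ℕ) :
    (cfQuad a B n).coeff 0 = cfQuadConst a B n ∧ (cfQuad a B n).coeff 1 = cfQuadMid a B n ∧
      (cfQuad a B n).coeff 2 = cfQuadLead a B n := by
  rw [cfQuad_eq]
  refine ⟨?_, ?_, ?_⟩ <;> simp [coeff_X, coeff_C]

theorem IsQuotSeq.logHeight_cfQuad (ha : IsQuotSeq a) (hBm : B.Monic)
    (hB : (a n).natDegree < B.natDegree) :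
    logHeight (cfQuad a B (n + 1)) = B.natDegree + cfDeg a (n + 1) + cfDeg a n := by
  obtain ⟨h1, h2⟩ := ha.natDegree_cfQuad_aux hB
  obtain ⟨c0, c1, c2⟩ := coeff_cfQuad a B (n + 1)
  have hq1 := (ha.natDegree_cfDen (n + 1)).le
  have hq0 := (ha.natDegree_cfDen n).le
  have hp1 := ha.natDegree_cfNum_le (n + 1)
  have hp0 := ha.natDegree_cfNum_le n
  have htwo : ∀ f g : F[X], (2 * (f * g)).natDegree ≤ f.natDegree + g.natDegree := by
    intro f g
    refine natDegree_mul_le.trans ?_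
    have := natDegree_mul_le (p := f) (q := g)
    rw [natDegree_ofNat]
    lia
  refine le_antisymm (Finset.sup_le fun i hi => ?_) ?_
  · rw [ha.natDegree_cfQuad hBm hB, Finset.mem_range] at hi
    interval_cases i
    · rw [c0, cfQuadConst]
      refine natDegree_sub_le_of_le (natDegree_add_le_of_degree_le ?_ ?_) ?_ |>.trans
        (max_self _).le
      · refine natDegree_mul_le_of_le (natDegree_mul_le_of_le le_rfl hp1) hp0
      · exact (natDegree_pow_le_of_le 2 hp0).trans h2.le
      · exact (natDegree_pow_le_of_le 2 hp1).trans h1.le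
    · rw [c1, cfQuadMid, natDegree_neg]
      refine natDegree_sub_le_of_le (natDegree_add_le_of_degree_le ?_ ?_) ?_ |>.trans
        (max_self _).le
      · refine (natDegree_mul_le_of_le le_rfl
          (natDegree_add_le_of_degree_le (natDegree_mul_le_of_le hq1 hp0)
            (natDegree_mul_le_of_le hp1 hq0))).trans ?_
        lia
      · exact (htwo _ _).trans (by lia)
      · exact (htwo _ _).trans (by lia)
    · rw [c2, (ha.monic_cfQuadLead_and hBm hB).2]
  · rw [← (ha.monic_cfQuadLead_and hBm hB).2, ← c2]
    exact natDegree_coeff_le_logHeight _ _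

/-- The homogenized quadratic is `B * u * v + v ^ 2 - u ^ 2` after a substitution of determinant
`±1`. It therefore takes the values `-1`, `1` and `-B` at two consecutive convergents and at their
sum, which yields primitivity and irreducibility. -/
theorem cfQuad_form (a : ℕ → F[X]) (B : F[X]) (n : ℕ) (x y : F[X]) :
    cfQuadLead a B n * x ^ 2 + cfQuadMid a B n * (x * y) + cfQuadConst a B n * y ^ 2
      = B * (cfDen a (n + 1) * x - cfNum a (n + 1) * y) * (cfDen a n * x - cfNum a n * y)
        + (cfDen a n * x - cfNum a n * y) ^ 2
        - (cfDen a (n + 1) * x - cfNum a (n + 1) * y) ^ 2 := by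
  simp only [cfQuadLead, cfQuadMid, cfQuadConst]
  ring

theorem cfNum_mul_cfDen_sub_sq (a : ℕ → F[X]) (n : ℕ) :
    (cfNum a n * cfDen a (n + 1) - cfNum a (n + 1) * cfDen a n) ^ 2 = 1 := by
  rw [cfNum_mul_cfDen_sub, ← pow_mul, mul_comm, pow_mul, neg_one_sq, one_pow]

theorem cfQuad_form_left (a : ℕ → F[X]) (B : F[X]) (n : ℕ) :
    cfQuadLead a B n * cfNum a n ^ 2 + cfQuadMid a B n * (cfNum a n * cfDen a n)
      + cfQuadConst a B n * cfDen a n ^ 2 = -1 := by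
  rw [cfQuad_form, ← cfNum_mul_cfDen_sub_sq a n]
  ring

theorem cfQuad_form_right (a : ℕ → F[X]) (B : F[X]) (n : ℕ) :
    cfQuadLead a B n * cfNum a (n + 1) ^ 2
      + cfQuadMid a B n * (cfNum a (n + 1) * cfDen a (n + 1))
      + cfQuadConst a B n * cfDen a (n + 1) ^ 2 = 1 := by
  rw [cfQuad_form, ← cfNum_mul_cfDen_sub_sq a n]
  ring

theorem cfQuad_form_add (a : ℕ → F[X]) (B : F[X]) (n : ℕ) :
    cfQuadLead a B n * (cfNum a n + cfNum a (n + 1)) ^ 2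
      + cfQuadMid a B n * ((cfNum a n + cfNum a (n + 1)) * (cfDen a n + cfDen a (n + 1)))
      + cfQuadConst a B n * (cfDen a n + cfDen a (n + 1)) ^ 2 = -B := by
  rw [cfQuad_form]
  linear_combination (-B) * cfNum_mul_cfDen_sub_sq a n

theorem isPrimitive_cfQuad (a : ℕ → F[X]) (B : F[X]) (n : ℕ) : (cfQuad a B n).IsPrimitive := by
  intro r hr
  rw [C_dvd_iff_dvd_coeff] at hr
  obtain ⟨c0, c1, c2⟩ := coeff_cfQuad a B n
  have h0 := c0 ▸ hr 0
  have h1 := c1 ▸ hr 1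
  have h2 := c2 ▸ hr 2
  refine isUnit_of_dvd_one ?_
  rw [← cfQuad_form_right a B n]
  exact ((h2.mul_right _).add (h1.mul_right _)).add (h0.mul_right _)

/-- Two linear factors would take unit values at both convergents, where the form is `±1`. By
additivity they would be constant at the sum of the convergents, where the form is `-B`. -/
theorem irreducible_cfQuad (hB : 0 < B.natDegree) (h2 : (cfQuad a B n).natDegree = 2) :
    Irreducible (cfQuad a B n) := by
  refine irreducible_of_isPrimitive (isPrimitive_cfQuad a B n) (by lia) (by lia) ?_
  intro f g hfg hf hg
  obtain ⟨u, -, v, rfl⟩ := natDegree_eq_one.1 hf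
  obtain ⟨u', -, v', rfl⟩ := natDegree_eq_one.1 hg
  have hprod : cfQuad a B n
      = C (u * u') * X ^ 2 + C (u * v' + u' * v) * X + C (v * v') := by
    rw [hfg]
    simp only [C_mul, C_add]
    ring
  obtain ⟨c0, c1, c2⟩ := coeff_cfQuad a B n
  have hform : ∀ x y : F[X], cfQuadLead a B n * x ^ 2 + cfQuadMid a B n * (x * y)
      + cfQuadConst a B n * y ^ 2 = (u * x + v * y) * (u' * x + v' * y) := by
    intro x y
    rw [← c0, ← c1, ← c2, hprod]
    simp only [coeff_add, coeff_C_mul, coeff_X_pow, coeff_X, coeff_C]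
    norm_num
    ring
  have e1 := (hform _ _).symm.trans (cfQuad_form_left a B n)
  have e2 := (hform _ _).symm.trans (cfQuad_form_right a B n)
  have e3 := (hform _ _).symm.trans (cfQuad_form_add a B n)
  set x₁ := u * cfNum a n + v * cfDen a n
  set y₁ := u' * cfNum a n + v' * cfDen a n
  set x₂ := u * cfNum a (n + 1) + v * cfDen a (n + 1)
  set y₂ := u' * cfNum a (n + 1) + v' * cfDen a (n + 1)
  have hx₁ : x₁.natDegree = 0 :=
    natDegree_eq_zero_of_isUnit (isUnit_of_mul_isUnit_left (e1 ▸ isUnit_one.neg))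
  have hy₁ : y₁.natDegree = 0 :=
    natDegree_eq_zero_of_isUnit (isUnit_of_mul_isUnit_right (e1 ▸ isUnit_one.neg))
  have hx₂ : x₂.natDegree = 0 :=
    natDegree_eq_zero_of_isUnit (isUnit_of_mul_isUnit_left (e2 ▸ isUnit_one))
  have hy₂ : y₂.natDegree = 0 :=
    natDegree_eq_zero_of_isUnit (isUnit_of_mul_isUnit_right (e2 ▸ isUnit_one))
  have e4 : B = -((x₁ + x₂) * (y₁ + y₂)) := by
    rw [← neg_eq_iff_eq_neg, ← e3]
    ring
  have h5 : B.natDegree ≤ 0 := by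
    rw [e4, natDegree_neg]
    exact natDegree_mul_le_of_le (natDegree_add_le_of_degree_le hx₁.le hx₂.le)
      (natDegree_add_le_of_degree_le hy₁.le hy₂.le)
  lia

theorem evalL_cfQuad (a : ℕ → F[X]) (B : F[X]) (n : ℕ) (ξ : F⸨X⸩) : evalL (cfQuad a B n) ξ
    = ofPoly F B * cfErr a ξ (n + 1) * cfErr a ξ n + cfErr a ξ n ^ 2 - cfErr a ξ (n + 1) ^ 2 := by
  rw [cfQuad, ← evalL_cfLin, ← evalL_cfLin]
  simp [evalL, eval₂_sub, eval₂_mul, eval₂_add, eval₂_pow]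

/-- Repeating `B` once more does not change the eventually constant continued fraction, so its
quadratic changes only by sign. The value may thus be computed at the end of a block of quotients
`B`. -/
theorem absL_evalL_cfQuad_succ (ξ : F⸨X⸩) (h : a n = B) :
    absL F (evalL (cfQuad a B (n + 1)) ξ) = absL F (evalL (cfQuad a B n) ξ) := by
  rw [← AbsoluteValue.map_neg]
  congr 1
  rw [evalL_cfQuad, evalL_cfQuad, cfErr_add_two, h]
  ring

theorem absL_evalL_cfQuad_add (ξ : F⸨X⸩) (k : ℕ) (h : ∀ i < k, a (n + i) = B) :
    absL F (evalL (cfQuad a B (n + k)) ξ) = absL F (evalL (cfQuad a B n) ξ) := by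
  induction k with
  | zero => rfl
  | succ k ih =>
    rw [← ih fun i hi => h i (by lia), ← add_assoc, absL_evalL_cfQuad_succ ξ (h k (by lia))]

/-- At a quotient of degree larger than that of `B`, the drop from `cfErr a ξ n` to the next error
outweighs `B`, and the square of `cfErr a ξ n` dominates. -/
theorem IsCF.absL_evalL_cfQuad {ξ : F⸨X⸩} (ha : IsQuotSeq a) (hξ : IsCF a ξ)
    (hB : B.natDegree < (a n).natDegree) :
    absL F (evalL (cfQuad a B n) ξ) = qr F (-(2 * cfDeg a n : ℝ)) := by
  have hlt : (cfDeg a n : ℝ) < cfDeg a (n + 1) := by exact_mod_cast ha.cfDeg_lt_succ n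
  have hsucc : (cfDeg a (n + 1) : ℝ) = cfDeg a n + (a n).natDegree := by
    exact_mod_cast cfDeg_succ a n
  have hB' : (B.natDegree : ℝ) < (a n).natDegree := by exact_mod_cast hB
  have e0 := hξ n
  have e1 := hξ (n + 1)
  have hsq : absL F (cfErr a ξ n ^ 2) = qr F (-(2 * cfDeg a n : ℝ)) := by
    rw [map_pow, e0, qr_pow]
    congr 1
    push_cast
    ring
  have h1 : absL F (ofPoly F B * cfErr a ξ (n + 1) * cfErr a ξ n) < absL F (cfErr a ξ n ^ 2) := by
    rw [hsq]
    by_cases h0 : B = 0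
    · rw [h0]
      simpa using qr_pos F _
    · rw [map_mul, map_mul, absL_ofPoly h0, e0, e1, ← qr_add, ← qr_add, qr_lt_qr]
      linarith
  have h2 : absL F (-cfErr a ξ (n + 1) ^ 2) < absL F (cfErr a ξ n ^ 2) := by
    rw [hsq, AbsoluteValue.map_neg, map_pow, e1, qr_pow, qr_lt_qr]
    push_cast
    linarith
  have h3 := isNonarchimedean_absL.add_eq_right_of_lt h1
  rw [evalL_cfQuad, sub_eq_add_neg, isNonarchimedean_absL.add_eq_left_of_lt (by rwa [h3]), h3, hsq]

theorem evalL_derivative_cfQuad (a : ℕ → F[X]) (B : F[X]) (n : ℕ) (ξ : F⸨X⸩) :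
    evalL (derivative (cfQuad a B n)) ξ
      = ofPoly F (B * cfDen a (n + 1)) * cfErr a ξ n
        + (ofPoly F (B * cfDen a n) * cfErr a ξ (n + 1)
        + (ofPoly F (2 * cfDen a n) * cfErr a ξ n
        + ofPoly F (-2 * cfDen a (n + 1)) * cfErr a ξ (n + 1))) := by
  have hadd : ∀ P Q : F[X][X], evalL (P + Q) ξ = evalL P ξ + evalL Q ξ := fun P Q => eval₂_add _ _
  have hsub : ∀ P Q : F[X][X], evalL (P - Q) ξ = evalL P ξ - evalL Q ξ := fun P Q => eval₂_sub _
  have hC : ∀ f : F[X], evalL (C f) ξ = ofPoly F f := fun f => eval₂_C _ _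
  have h2 : evalL (2 : F[X][X]) ξ = 2 := by simp [evalL]
  simp only [cfQuad, derivative_sub, derivative_add, derivative_mul, derivative_C, pow_two, zero_mul,
    zero_add, hadd, hsub, evalL_mul, hC, evalL_cfLin, evalL_derivative_cfLin, map_mul, map_neg,
    map_ofNat]
  ring

theorem absL_ofPoly_le {f : F[X]} {m : ℕ} (h : f.natDegree ≤ m) :
    absL F (ofPoly F f) ≤ qr F m := by
  by_cases h0 : f = 0
  · rw [h0, map_zero, map_zero]
    exact (qr_pos F _).le
  · rw [absL_ofPoly h0, qr_le_qr]
    exact_mod_cast h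

/-- The dominant term is `B` times the denominator of index `n + 2` times the error of index `n +
1`, and the last two have reciprocal absolute values. -/
theorem IsCF.absL_evalL_derivative_cfQuad {ξ : F⸨X⸩} (ha : IsQuotSeq a) (hξ : IsCF a ξ)
    (hBm : B.Monic) (hB0 : 0 < B.natDegree) :
    absL F (evalL (derivative (cfQuad a B (n + 1))) ξ) = qr F B.natDegree := by
  have hlt : (cfDeg a n : ℝ) < cfDeg a (n + 1) := by exact_mod_cast ha.cfDeg_lt_succ n
  have hlt' : (cfDeg a (n + 1) : ℝ) < cfDeg a (n + 2) := by
    exact_mod_cast ha.cfDeg_lt_succ (n + 1)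
  have hB' : (0 : ℝ) < B.natDegree := by exact_mod_cast hB0
  have hmain : absL F (ofPoly F (B * cfDen a (n + 2)) * cfErr a ξ (n + 1)) = qr F B.natDegree := by
    rw [map_mul, map_mul, map_mul, absL_ofPoly hBm.ne_zero, ha.absL_cfDen, hξ, ← qr_add, ← qr_add]
    congr 1
    ring
  have hbound : ∀ (f : F[X]) (m k : ℕ), f.natDegree ≤ m → (m : ℝ) - cfDeg a k < B.natDegree →
      absL F (ofPoly F f * cfErr a ξ k) < qr F B.natDegree := by
    intro f m k hf hm
    rw [map_mul, hξ]
    refine (mul_le_mul_of_nonneg_right (absL_ofPoly_le hf) (qr_pos F _).le).trans_lt ?_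
    rw [← qr_add, qr_lt_qr]
    linarith
  rw [evalL_derivative_cfQuad, isNonarchimedean_absL.add_eq_left_of_lt, hmain]
  rw [hmain]
  refine (absL_add_le_max _ _).trans_lt (max_lt ?_ ((absL_add_le_max _ _).trans_lt (max_lt ?_ ?_)))
  · refine hbound _ (B.natDegree + cfDeg a n) _
      (natDegree_mul_le_of_le le_rfl (ha.natDegree_cfDen _).le) ?_
    push_cast
    linarith
  · refine hbound _ (0 + cfDeg a n) _
      (natDegree_mul_le_of_le (by simp) (ha.natDegree_cfDen _).le) ?_
    push_cast
    linarith
  · refine hbound _ (0 + cfDeg a (n + 1)) _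
      (natDegree_mul_le_of_le (by simp) (ha.natDegree_cfDen _).le) ?_
    push_cast
    linarith

end Quadratics

/-! ### Construction of the continued fractions. -/

section Constructions

variable {F : Type*} [Field F] [Fintype F]

variable (F) in
/-- The monic polynomial `T ^ m + 1` or `T ^ m`. -/
def powAddBit (m : ℕ) (e : Bool) : F[X] := X ^ m + C (if e then 1 else 0)

theorem monic_powAddBit {m : ℕ} (hm : 0 < m) (e : Bool) : (powAddBit F m e).Monic :=
  monic_X_pow_add_C _ hm.ne'

theorem natDegree_powAddBit (m : ℕ) (e : Bool) : (powAddBit F m e).natDegree = m :=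
  natDegree_X_pow_add_C

theorem powAddBit_injective (m : ℕ) : Function.Injective (powAddBit F m) := by
  intro e e' h
  have h1 := C_injective (add_left_cancel h)
  cases e <;> cases e' <;> simp_all

/-! ### The case `δ = 0`: rapidly growing partial quotients. -/

section Zero

/-- The degrees of the partial quotients for which `cfDeg` runs through the powers of `θ`. -/
def powDeg (θ : ℕ) : ℕ → ℕ
  | 0 => 1
  | k + 1 => θ ^ (k + 1) - θ ^ k

theorem powDeg_pos {θ : ℕ} (hθ : 1 < θ) (k : ℕ) : 0 < powDeg θ k := by
  rcases k with _ | k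
  · exact one_pos
  · have := Nat.pow_lt_pow_right hθ (Nat.lt_succ_self k)
    simp only [powDeg]
    lia

theorem isQuotSeq_powDeg {θ : ℕ} (hθ : 1 < θ) (e : ℕ → Bool) :
    IsQuotSeq fun k => powAddBit F (powDeg θ k) (e k) where
  monic k := monic_powAddBit (powDeg_pos hθ k) _
  natDegree_pos k := by
    rw [natDegree_powAddBit]
    exact powDeg_pos hθ k

theorem cfDeg_powDeg {θ : ℕ} (hθ : 1 < θ) (e : ℕ → Bool) (k : ℕ) :
    cfDeg (fun k => powAddBit F (powDeg θ k) (e k)) (k + 1) = θ ^ k := by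
  induction k with
  | zero => simp [cfDeg, natDegree_powAddBit, powDeg]
  | succ k ih =>
    have := Nat.pow_lt_pow_right hθ (Nat.lt_succ_self k)
    rw [cfDeg_succ, ih, natDegree_powAddBit, powDeg]
    lia

theorem exists_injective_wExp_sub_wStar_eq_zero (d : ℕ) :
    ∃ f : (ℕ → Bool) → F⸨X⸩, Function.Injective f ∧
      ∀ e n, 2 ≤ n → n ≤ d → wExp n (f e) - wStar n (f e) = ((0 : ℝ) : EReal) := by
  -- Here `v k = θ * h k` and `h (k + 1) = v k`, so `K = 1` and the requirement `2 + 4 * d * K ≤ θ`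
  -- is met with equality.
  obtain ⟨θ, hθ⟩ : ∃ θ : ℕ, θ = 4 * d + 2 := ⟨_, rfl⟩
  have hθ1 : 1 < θ := by lia
  choose f hf using fun e => (isQuotSeq_powDeg (F := F) hθ1 e).exists_isCF
  refine ⟨f, fun e e' h => ?_, fun e n hn hnd => ?_⟩
  · have h1 := IsCF.eq (isQuotSeq_powDeg hθ1 e) (isQuotSeq_powDeg hθ1 e') (hf e) (h ▸ hf e')
    exact funext fun k => powAddBit_injective _ (congrFun h1 k)
  · have ha := isQuotSeq_powDeg (F := F) hθ1 e
    have hs := IsCF.isApproxSeq_cfLin ha (hf e)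
    have hh : ∀ k, logHeight (cfLin (fun k => powAddBit F (powDeg θ k) (e k)) (k + 2)) = θ ^ k :=
      fun k => by rw [ha.logHeight_cfLin, cfDeg_powDeg hθ1]
    have hv : ∀ k, ((θ ^ (k + 1) : ℕ) : ℝ) = θ * (θ ^ k : ℕ) := fun k => by
      push_cast
      ring
    have hθd : (θ : ℝ) = 4 * d + 2 := by
      rw [hθ]
      push_cast
      ring
    refine hs.wExp_sub_wStar (d := d) (K := 1) (C := θ) ⟨?_, fun k => ?_, fun k => ?_, zero_le_one⟩
      zero_le_one (fun k => ?_) (fun k => ?_) ?_ hn hnd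
    · simp only [hh]
      exact tendsto_natCast_atTop_atTop.comp (tendsto_pow_atTop_atTop_of_one_lt hθ1)
    · rw [hh, cfDeg_powDeg hθ1, one_mul]
    · rw [hh, cfDeg_powDeg hθ1, hv, hθd]
      have : (0 : ℝ) ≤ d := Nat.cast_nonneg d
      exact mul_le_mul_of_nonneg_right (by linarith) (Nat.cast_nonneg _)
    · rw [hh, cfDeg_powDeg hθ1, hv, hθd]
      exact mul_le_mul_of_nonneg_right (by linarith) (Nat.cast_nonneg _)
    · rw [hh, cfDeg_powDeg hθ1, hv]
    · simp only [hh, cfDeg_powDeg hθ1]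
      refine tendsto_const_nhds.congr fun k => ?_
      have : ((θ ^ k : ℕ) : ℝ) ≠ 0 := by positivity
      rw [div_self this, sub_zero]

end Zero

/-! ### Partial quotients constant on blocks. -/

section Blocks

/-- The index of the block containing `i`, when the block of index `k` starts at `N k`. -/
def blockIndex (N : ℕ → ℕ) (i : ℕ) : ℕ := Nat.findGreatest (fun k => N k ≤ i) i

theorem blockIndex_eq {N : ℕ → ℕ} (hN : StrictMono N) {k i : ℕ} (h1 : N k ≤ i)
    (h2 : i < N (k + 1)) : blockIndex N i = k := by
  rw [blockIndex, Nat.findGreatest_eq_iff]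
  refine ⟨hN.le_apply.trans h1, fun _ => h1, fun j hj _ h => ?_⟩
  exact absurd (hN.monotone (Nat.succ_le_of_lt hj)) (not_le.2 (h.trans_lt h2))

theorem cfDeg_add_of_forall_eq {a : ℕ → F[X]} {B : F[X]} {n k : ℕ}
    (h : ∀ i < k, a (n + i) = B) : cfDeg a (n + k) = cfDeg a n + k * B.natDegree := by
  induction k with
  | zero => simp
  | succ k ih =>
    rw [← add_assoc, cfDeg_succ, ih fun i hi => h i (by lia), h k (by lia)]
    ring

/-- If the partial quotients are constant on blocks, and of increasing degree from one block to
the next, then the quadratic polynomials attached to the blocks are good approximations. -/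
theorem IsCF.isApproxSeq_cfQuad {a : ℕ → F[X]} {ξ : F⸨X⸩} (ha : IsQuotSeq a) (hξ : IsCF a ξ)
    {N : ℕ → ℕ} (hN : StrictMono N) {B : ℕ → F[X]} {b Q : ℕ → ℕ} (hB : ∀ k, (B k).Monic)
    (hb : ∀ k, (B k).natDegree = b k) (hmono : StrictMono b)
    (hblock : ∀ k i, N k ≤ i → i < N (k + 1) → a i = B k) (hQ : ∀ k, cfDeg a (N k) = Q k) :
    IsApproxSeq ξ (fun k => cfQuad a (B (k + 1)) (N (k + 1))) (fun k => b (k + 1))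
      (fun k => 2 * Q (k + 2)) ∧
    ∀ k, logHeight (cfQuad a (B (k + 1)) (N (k + 1))) = 2 * Q (k + 1) - b k + b (k + 1) := by
  have hstart : ∀ k, a (N k) = B k := fun k => hblock k _ le_rfl (hN (Nat.lt_succ_self k))
  have hpred : ∀ k, ∃ n, N (k + 1) = n + 1 ∧ a n = B k := by
    intro k
    have h1 := hN (Nat.lt_succ_self k)
    exact ⟨N (k + 1) - 1, by lia, hblock k _ (by lia) (by lia)⟩
  have hb1 : ∀ k, b k < b (k + 1) := fun k => hmono (Nat.lt_succ_self k)
  have hheight : ∀ k, logHeight (cfQuad a (B (k + 1)) (N (k + 1)))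
      = 2 * Q (k + 1) - b k + b (k + 1) := by
    intro k
    obtain ⟨n, hn, han⟩ := hpred k
    have h1 := cfDeg_succ a n
    have h2 := hQ (k + 1)
    rw [hn] at h2 ⊢
    rw [ha.logHeight_cfQuad (hB _) (by rw [han, hb, hb]; exact hb1 k), hb]
    rw [han, hb] at h1
    lia
  have hlt : ∀ k, Q (k + 1) + b (k + 1) ≤ Q (k + 2) := by
    intro k
    have h1 := cfDeg_succ a (N (k + 1))
    have h2 := ha.strictMono_cfDeg.monotone (Nat.succ_le_of_lt (hN (Nat.lt_succ_self (k + 1))))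
    rw [hstart, hb, hQ] at h1
    rw [hQ] at h2
    exact h1 ▸ h2
  have hbpos : ∀ k, 0 < b k := by
    intro k
    rw [← hb, ← hstart]
    exact ha.natDegree_pos _
  have hdeg2 : ∀ k, (cfQuad a (B (k + 1)) (N (k + 1))).natDegree = 2 ∧
      (cfQuad a (B (k + 1)) (N (k + 1))).leadingCoeff = cfQuadLead a (B (k + 1)) (N (k + 1)) ∧
      (cfQuadLead a (B (k + 1)) (N (k + 1))).Monic ∧
      (cfQuadLead a (B (k + 1)) (N (k + 1))).natDegree = 2 * Q (k + 1) - b k + b (k + 1) := by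
    intro k
    obtain ⟨n, hn, han⟩ := hpred k
    have h3 : (a n).natDegree < (B (k + 1)).natDegree := by
      rw [han, hb, hb]
      exact hb1 k
    rw [← hheight, hn]
    refine ⟨ha.natDegree_cfQuad (hB _) h3, ha.leadingCoeff_cfQuad (hB _) h3,
      (ha.monic_cfQuadLead_and (hB _) h3).1, ?_⟩
    rw [(ha.monic_cfQuadLead_and (hB _) h3).2, ha.logHeight_cfQuad (hB _) h3]
  refine ⟨⟨hξ.absL_le_one, fun k => ?_, fun k => ?_, fun k => ?_, fun k => ?_, fun k => ?_,
    fun k => ?_, fun k => ?_, fun k => ?_, fun k => ?_⟩, hheight⟩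
  · rw [(hdeg2 k).1]
    exact two_pos
  · exact (hdeg2 k).1.le
  · refine irreducible_cfQuad ?_ (hdeg2 k).1
    rw [hb]
    exact hbpos _
  · exact isPrimitive_cfQuad _ _ _
  · rw [(hdeg2 k).2.1]
    exact (hdeg2 k).2.2.1
  · rw [(hdeg2 k).2.1, (hdeg2 k).2.2.2, hheight]
  -- The quadratic is moved, up to sign, from the start of block `k + 1` to the start of block `k +
  -- 2`, where the next quotient has larger degree.
  · obtain ⟨j, hj⟩ := Nat.exists_eq_add_of_le (hN (Nat.lt_succ_self (k + 1))).le
    rw [← absL_evalL_cfQuad_add ξ j fun i hi => hblock (k + 1) _ (by lia) (by lia), ← hj,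
      hξ.absL_evalL_cfQuad ha (by rw [hstart, hb, hb]; exact hb1 _), hQ]
    push_cast
    rfl
  · obtain ⟨n, hn, -⟩ := hpred k
    rw [hn, hξ.absL_evalL_derivative_cfQuad ha (hB _) (by rw [hb]; exact hbpos _), hb]
  · rw [hheight]
    have h1 := hlt k
    have h2 := hbpos k
    have h3 := hbpos (k + 1)
    lia

end Blocks

/-! ### Choice of block lengths and degrees. -/

section Parameters

/-- The degree `b k` of the partial quotients in the block of index `k`, the length `m k` of this
block, and the sum `Q k` of the degrees of all partial quotients before it. -/
def blockData (c : ℝ) (θ : ℕ) : ℕ → ℕ × ℕ × ℕ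
  | 0 => (1, 1, 0)
  | k + 1 =>
    let Q := (blockData c θ k).2.2 + (blockData c θ k).2.1 * (blockData c θ k).1
    let S := 2 * Q - (blockData c θ k).1
    -- The summand `k + 2` keeps `b` strictly increasing even for `c = 0`. It is negligible because
    -- `S` grows at least like `2 ^ k`.
    let b := ⌊c * S⌋₊ + (k + 2)
    -- This length makes the total degree of the block exceed `θ * S`, by at most `b`.
    (b, θ * S / b + 1, Q)

theorem exists_block_parameters {c : ℝ} (hc : 0 ≤ c) {θ : ℕ} (hθ : 1 ≤ θ) :
    ∃ b m Q S : ℕ → ℕ, StrictMono b ∧ (∀ k, 0 < b k) ∧ (∀ k, 0 < m k) ∧ Q 0 = 0 ∧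
      (∀ k, Q (k + 1) = Q k + m k * b k) ∧ (∀ k, S k = 2 * Q (k + 1) - b k) ∧
      (∀ k, k ≤ S k) ∧ (∀ k, (b (k + 1) : ℝ) ≤ (c + 2) * S k) ∧
      (∀ k, θ * S k ≤ Q (k + 2)) ∧ (∀ k, 2 * Q (k + 2) ≤ (2 * θ + 1) * S k + 3 * b (k + 1)) ∧
      Tendsto (fun k => (b (k + 1) : ℝ) / S k) atTop (𝓝 c) := by
  let b : ℕ → ℕ := fun k => (blockData c θ k).1
  let m : ℕ → ℕ := fun k => (blockData c θ k).2.1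
  let Q : ℕ → ℕ := fun k => (blockData c θ k).2.2
  let S : ℕ → ℕ := fun k => 2 * Q (k + 1) - b k
  have hQ : ∀ k, Q (k + 1) = Q k + m k * b k := fun k => rfl
  have hb : ∀ k, b (k + 1) = ⌊c * S k⌋₊ + (k + 2) := fun k => rfl
  have hm : ∀ k, m (k + 1) = θ * S k / b (k + 1) + 1 := fun k => rfl
  have hbpos : ∀ k, 0 < b k := by
    rintro (_ | k)
    · exact one_pos
    · rw [hb]
      lia
  have hmpos : ∀ k, 0 < m k := by
    rintro (_ | k)
    · exact one_pos
    · exact Nat.succ_pos _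
  have hbm : ∀ k, b k ≤ m k * b k := fun k => Nat.le_mul_of_pos_left _ (hmpos k)
  have hS : ∀ k, S k + b k = 2 * Q (k + 1) := by
    intro k
    have := hQ k
    have := hbm k
    simp only [S]
    lia
  have hmb1 : ∀ k, θ * S k < m (k + 1) * b (k + 1) := by
    intro k
    rw [hm, add_mul, one_mul]
    exact Nat.lt_div_mul_add (hbpos _)
  have hmb2 : ∀ k, m (k + 1) * b (k + 1) ≤ θ * S k + b (k + 1) := by
    intro k
    rw [hm, add_mul, one_mul]
    exact Nat.add_le_add_right (Nat.div_mul_le_self _ _) _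
  have hSθ : ∀ k, S k ≤ θ * S k := fun k => Nat.le_mul_of_pos_left _ hθ
  have hSsucc : ∀ k, 2 * S k ≤ S (k + 1) := by
    intro k
    have h1 := hS k
    have h2 := hS (k + 1)
    have h3 := hQ (k + 1)
    have h4 := hmb1 k
    have h5 := hSθ k
    have h6 := hbm (k + 1)
    lia
  have hSpow : ∀ k, 2 ^ k ≤ S k := by
    intro k
    induction k with
    | zero => simp [S, Q, b, blockData]
    | succ k ih =>
      have := hSsucc k
      rw [pow_succ]
      lia
  have hSk : ∀ k, k + 1 ≤ S k := fun k => Nat.lt_two_pow_self.trans_le (hSpow k)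
  have hmono : StrictMono b := by
    refine strictMono_nat_of_lt_succ fun k => ?_
    rcases k with _ | k
    · rw [hb]
      simp only [b, blockData]
      lia
    · rw [hb, hb]
      have h1 : ⌊c * S k⌋₊ ≤ ⌊c * S (k + 1)⌋₊ := by
        have h2 : (S k : ℝ) ≤ S (k + 1) := by
          have := hSsucc k
          exact_mod_cast (by lia : S k ≤ S (k + 1))
        exact Nat.floor_mono (by gcongr)
      lia
  have hfl : ∀ k, (⌊c * S k⌋₊ : ℝ) ≤ c * S k := fun k => Nat.floor_le (by positivity)
  refine ⟨b, m, Q, S, hmono, hbpos, hmpos, rfl, hQ, fun k => rfl, fun k => (hSk k).trans' (by lia),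
    fun k => ?_, fun k => ?_, fun k => ?_, ?_⟩
  · have h1 : ((k + 1 : ℕ) : ℝ) ≤ S k := by exact_mod_cast hSk k
    have h2 : (0 : ℝ) ≤ k := Nat.cast_nonneg k
    rw [hb]
    push_cast at h1 ⊢
    linarith [hfl k]
  · have h1 := hQ (k + 1)
    have h2 := hmb1 k
    lia
  · have h1 := hQ (k + 1)
    have h2 := hmb2 k
    have h3 := hS k
    have h4 : b k < b (k + 1) := hmono (Nat.lt_succ_self k)
    have h5 : (2 * θ + 1) * S k = 2 * (θ * S k) + S k := by ring
    lia
  · have hStop : Tendsto (fun k => (S k : ℝ)) atTop atTop :=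
      tendsto_natCast_atTop_atTop.comp
        (tendsto_atTop_mono (fun k => (hSk k).trans' (Nat.le_succ k)) tendsto_id)
    have h1 : Tendsto (fun k => (⌊c * S k⌋₊ : ℝ) / S k) atTop (𝓝 c) :=
      (tendsto_nat_floor_mul_div_atTop hc).comp hStop
    have h2 : Tendsto (fun k : ℕ => ((k : ℝ) ^ 1 / 2 ^ k) + 2 * (1 / 2 : ℝ) ^ k) atTop
        (𝓝 (0 + 2 * 0)) :=
      (tendsto_pow_const_div_const_pow_of_one_lt 1 one_lt_two).add
        ((tendsto_pow_atTop_nhds_zero_of_lt_one (by norm_num) (by norm_num)).const_mul 2)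
    have h3 : Tendsto (fun k : ℕ => ((k : ℝ) + 2) / S k) atTop (𝓝 0) := by
      rw [mul_zero, add_zero] at h2
      refine squeeze_zero (fun k => by positivity) (fun k => ?_) h2
      have h4 : ((2 : ℝ) ^ k) ≤ S k := by exact_mod_cast hSpow k
      have h5 : ((k : ℝ) + 2) / S k ≤ (k + 2) / 2 ^ k := by gcongr
      refine h5.trans (le_of_eq ?_)
      rw [pow_one, add_div, one_div, inv_pow, div_eq_mul_inv (2 : ℝ)]
    refine ((h1.add h3).congr fun k => ?_).trans (by rw [add_zero])
    rw [hb, ← add_div]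
    push_cast
    rfl

end Parameters

/-! ### The case `δ > 0`, and the conclusion. -/

theorem exists_injective_wExp_sub_wStar_eq_of_pos (d : ℕ) {δ : ℝ} (hδ0 : 0 < δ) (hδ1 : δ ≤ 1) :
    ∃ f : (ℕ → Bool) → F⸨X⸩, Function.Injective f ∧
      ∀ e n, 2 ≤ n → n ≤ d → wExp n (f e) - wStar n (f e) = (δ : EReal) := by
  -- The logarithmic height is `S k + b (k + 1)` with `b (k + 1) / S k → c`, so `c` has to solve `c
  -- / (1 + c) = 1 - δ`.
  obtain ⟨c, hc⟩ : ∃ c, c = (1 - δ) / δ := ⟨_, rfl⟩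
  have hc0 : 0 ≤ c := hc ▸ div_nonneg (by linarith) hδ0.le
  -- With `K = c + 3`, the second factor exceeds both `2 * d + 1` and `2 + 4 * d * K`, the two
  -- ratios required of `v k` to the height. The first factor bounds the height by a multiple of `S
  -- k`.
  obtain ⟨θ, hθ⟩ : ∃ θ : ℕ, (c + 3) * (2 * d + 2 + 4 * d * (c + 3)) ≤ θ := ⟨_, Nat.le_ceil _⟩
  have hθ1 : 1 ≤ θ := by
    have h1 : (1 : ℝ) ≤ (c + 3) * (2 * d + 2 + 4 * d * (c + 3)) :=
      one_le_mul_of_one_le_of_one_le (by linarith) (by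
        have : (0 : ℝ) ≤ 2 * d + 4 * d * (c + 3) := by positivity
        linarith)
    exact_mod_cast h1.trans hθ
  obtain ⟨b, m, Q, S, hmono, hbpos, hmpos, hQ0, hQ, hS, hSk, hbS, hθQ, hQθ, hlim⟩ :=
    exists_block_parameters hc0 hθ1
  let N : ℕ → ℕ := fun k => ∑ i ∈ Finset.range k, m i
  have hNsucc : ∀ k, N (k + 1) = N k + m k := fun k => Finset.sum_range_succ _ _
  have hN : StrictMono N := strictMono_nat_of_lt_succ fun k => by
    have := hmpos k
    have := hNsucc k
    lia
  let a : (ℕ → Bool) → ℕ → F[X] := fun e i =>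
    powAddBit F (b (blockIndex N i)) (e (blockIndex N i))
  have ha : ∀ e, IsQuotSeq (a e) := fun e =>
    ⟨fun i => monic_powAddBit (hbpos _) _, fun i => by
      simp only [a]
      rw [natDegree_powAddBit]
      exact hbpos _⟩
  have hblock : ∀ e k i, N k ≤ i → i < N (k + 1) → a e i = powAddBit F (b k) (e k) := by
    intro e k i h1 h2
    simp only [a, blockIndex_eq hN h1 h2]
  have hdeg : ∀ e k, cfDeg (a e) (N k) = Q k := by
    intro e k
    induction k with
    | zero => simp [N, cfDeg, hQ0]
    | succ k ih =>
      rw [hNsucc, cfDeg_add_of_forall_eq fun i hi =>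
        hblock e k (N k + i) (by lia) (by rw [hNsucc]; lia), ih, natDegree_powAddBit, hQ]
  choose f hf using fun e => (ha e).exists_isCF
  refine ⟨f, fun e e' h => ?_, fun e n hn hnd => ?_⟩
  · have h1 := IsCF.eq (ha e) (ha e') (hf e) (h ▸ hf e')
    funext k
    have h2 := congrFun h1 (N k)
    rw [hblock e k _ le_rfl (hN (Nat.lt_succ_self k)),
      hblock e' k _ le_rfl (hN (Nat.lt_succ_self k))] at h2
    exact powAddBit_injective _ h2
  · obtain ⟨hs, hh⟩ := (hf e).isApproxSeq_cfQuad (ha e) hN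
      (B := fun k => powAddBit F (b k) (e k)) (fun k => monic_powAddBit (hbpos k) _)
      (fun k => natDegree_powAddBit _ _) hmono (hblock e) (hdeg e)
    have hh' : ∀ k, (logHeight (cfQuad (a e) (powAddBit F (b (k + 1)) (e (k + 1))) (N (k + 1))) : ℝ)
        = S k + b (k + 1) := fun k => by
      rw [hh, ← hS]
      push_cast
      rfl
    have hhS : ∀ k, (S k : ℝ) + b (k + 1) ≤ (c + 3) * S k := fun k => by linarith [hbS k]
    have hvlow : ∀ k, (2 * d + 2 + 4 * d * (c + 3)) * ((S k : ℝ) + b (k + 1))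
        ≤ (2 * Q (k + 2) : ℕ) := by
      intro k
      have h1 : (θ : ℝ) * S k ≤ Q (k + 2) := by exact_mod_cast hθQ k
      have h2 : (2 * d + 2 + 4 * d * (c + 3)) * ((S k : ℝ) + b (k + 1))
          ≤ (2 * d + 2 + 4 * d * (c + 3)) * ((c + 3) * S k) := by
        gcongr
        exact hhS k
      have h3 : (c + 3) * (2 * d + 2 + 4 * d * (c + 3)) * (S k : ℝ) ≤ θ * S k := by gcongr
      have h4 : (0 : ℝ) ≤ Q (k + 2) := Nat.cast_nonneg _
      push_cast
      linarith
    have hpos : ∀ k, (0 : ℝ) ≤ (S k : ℝ) + b (k + 1) := fun k => by positivity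
    refine hs.wExp_sub_wStar (d := d) (K := c + 3) (C := 2 * θ + 4)
      ⟨?_, fun k => ?_, fun k => ?_, by linarith⟩ hδ1 (fun k => ?_) (fun k => ?_) ?_ hn hnd
    · simp only [hh']
      refine tendsto_atTop_mono (fun k => ?_) tendsto_natCast_atTop_atTop
      have h1 : (k : ℝ) ≤ S k := by exact_mod_cast hSk k
      have h2 : (0 : ℝ) ≤ b (k + 1) := Nat.cast_nonneg _
      linarith
    · rw [hh']
      refine (hhS (k + 1)).trans ?_
      have h1 : (S (k + 1) : ℝ) ≤ (2 * Q (k + 2) : ℕ) := by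
        rw [hS]
        exact_mod_cast Nat.sub_le _ _
      gcongr
    · rw [hh']
      refine le_trans (mul_le_mul_of_nonneg_right ?_ (hpos k)) (hvlow k)
      have : (0 : ℝ) ≤ 4 * d * (c + 3) := by positivity
      linarith
    · rw [hh']
      refine le_trans (mul_le_mul_of_nonneg_right ?_ (hpos k)) (hvlow k)
      have : (0 : ℝ) ≤ 2 * d := by positivity
      linarith
    · rw [hh']
      have h1 : ((2 * Q (k + 2) : ℕ) : ℝ) ≤ (2 * θ + 1) * S k + 3 * b (k + 1) := by
        exact_mod_cast hQθ k
      refine h1.trans ?_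
      have h2 : (0 : ℝ) ≤ S k := Nat.cast_nonneg _
      have h3 : (0 : ℝ) ≤ 2 * θ * b (k + 1) := by positivity
      have h4 : (0 : ℝ) ≤ b (k + 1) := Nat.cast_nonneg _
      linarith
    · have h1 : 1 - δ = c / (1 + c) := by
        rw [hc]
        field_simp
        ring
      rw [h1]
      refine (hlim.div (hlim.const_add 1) (by linarith)).congr' ?_
      filter_upwards [eventually_gt_atTop 0] with k hk
      have h2 : (S k : ℝ) ≠ 0 := by
        have := hSk k
        exact_mod_cast (by lia : S k ≠ 0)
      rw [hh']
      have h3 : (S k : ℝ) + b (k + 1) ≠ 0 := by positivity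
      simp only [Pi.div_apply]
      field_simp

theorem exists_injective_wExp_sub_wStar_eq (d : ℕ) {δ : ℝ} (hδ : δ ∈ Set.Icc (0 : ℝ) 1) :
    ∃ f : (ℕ → Bool) → F⸨X⸩, Function.Injective f ∧
      ∀ e n, 2 ≤ n → n ≤ d → wExp n (f e) - wStar n (f e) = (δ : EReal) := by
  rcases hδ.1.eq_or_lt with rfl | h
  · exact exists_injective_wExp_sub_wStar_eq_zero d
  · exact exists_injective_wExp_sub_wStar_eq_of_pos d h hδ.2

end Constructions

end FqLaurent

end

/-- In `EReal` a difference with an infinite term is infinite (in particular `⊤ - ⊤ = ⊥`), so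
equality with a real `δ` includes the finiteness of both exponents. -/
theorem mainTheorem6 (F : Type*) [Field F] [Fintype F] (d : ℕ) (hd : 2 ≤ d) :
    (∀ δ : ℝ, δ ∈ Set.Icc (0 : ℝ) 1 →
      ¬ {ξ : LaurentSeries F | ∀ n : ℕ, 2 ≤ n → n ≤ d →
          FqLaurent.wExp n ξ - FqLaurent.wStar n ξ = (δ : EReal)}.Countable) ∧
    (fun δ : ℝ => (δ : EReal)) '' Set.Icc (0 : ℝ) 1 ⊆
      Set.range (fun ξ : LaurentSeries F => FqLaurent.wExp d ξ - FqLaurent.wStar d ξ) := by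
  refine ⟨fun δ hδ hcount => ?_, ?_⟩
  · obtain ⟨f, hf, h⟩ := FqLaurent.exists_injective_wExp_sub_wStar_eq (F := F) d hδ
    have h1 : (Set.univ : Set (ℕ → Bool)).Countable :=
      (hcount.preimage hf).mono fun e _ => h e
    obtain ⟨g, hg⟩ := (Set.countable_univ_iff.1 h1).exists_injective_nat
    classical
    -- Countability would inject binary sequences, hence the subsets of `ℕ`, into `ℕ`.
    refine Function.cantor_injective (fun s : Set ℕ => g fun n => decide (n ∈ s)) fun s t hst => ?_
    ext n
    exact decide_eq_decide.1 (congrFun (hg hst) n)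
  · rintro _ ⟨δ, hδ, rfl⟩
    obtain ⟨f, -, h⟩ := FqLaurent.exists_injective_wExp_sub_wStar_eq (F := F) d hδ
    exact ⟨f fun _ => true, h _ d hd le_rfl⟩
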